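/- Let $K$ be a number field and let $d > 1$ and $n \ge 0$ be integers. Write $f^n$ for the $n$-th iterate of a polynomial $f$ under composition ($f^0(x)=x$), and $[S_d]^n$ for the $n$-th iterated wreath product of the symmetric group $S_d$ acting on $d$ letters: $[S_d]^0$ is trivial, and $[S_d]^{n+1} = S_d[[S_d]^n] = ([S_d]^n)^d \rtimes S_d$, where $S_d$ permutes the $d$ factors. There is a Zariski dense subset $\mathcal{H}$ of $K^d$ such that, for every monic polynomial $f(x)\in K[x]$ of degree $d$ with critical points $b_1,\dots,b_{d-1}\in K$ (listed with multiplicity, i.e. $f'(x)=d\prod_{i=1}^{d-1}(x-b_i)$) and constant term $c_0$ such that $(b_1,\dots,b_{d-1},c_0)\in\mathcal{H}$, \[ \operatorname{Gal}\bigl(K\bigl((f'\circ f^n)^{-1}(0)\bigr)/K\bigr)\;\cong\;\prod_{i=1}^{d-1}[S_d]^n , \] where $K((f'\circ f^n)^{-1}(0))$ is the field generated over $K$ by all roots of $f'\circ f^n$ in an algebraic closure of $K$. -/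

import Mathlib

/-- The permutational wreath product `S_d[G]`: the semidirect product of `G ^ d` by the symmetric
group `S_d`, which permutes the `d` factors. -/
abbrev SymWreath (d : ℕ) (G : Type) [Group G] : Type :=
  (Fin d → G) ⋊[mulAutArrow] Equiv.Perm (Fin d)

/-- The `n`-th iterated wreath product `[S_d]^n` of the symmetric group `S_d` in its natural action
on `d` letters (the automorphism group of the complete rooted `d`-ary tree of height `n`):
`[S_d]^0` is trivial and `[S_d]^(n+1) = S_d[[S_d]^n]`. -/
def iteratedSymWreath (d : ℕ) : ℕ → GrpCat.{0}
  | 0 => GrpCat.of Unit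
  | n + 1 => GrpCat.of (SymWreath d (iteratedSymWreath d n))

/-- A subset of affine space is Zariski dense if its Zariski closure, the common zero locus of all
polynomials vanishing on it, is the whole space. -/
def IsZariskiDense {K : Type*} [Field K] {σ : Type*} (S : Set (σ → K)) : Prop :=
  MvPolynomial.zeroLocus K (MvPolynomial.vanishingIdeal K S) = Set.univ

/-- The point `(b_1, …, b_{d-1}, c)` of `K ^ d`. -/
def paramPoint {K : Type*} {d : ℕ} (b : Fin (d - 1) → K) (c : K) : Fin d → K :=
  fun i => if h : (i : ℕ) < d - 1 then b ⟨i, h⟩ else c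

/-- The `n`-th iterate `f^n` of a polynomial under composition, with `f^0 = X`. -/
noncomputable def polyIterate {K : Type*} [Field K] (f : Polynomial K) (n : ℕ) : Polynomial K :=
  f.comp^[n] Polynomial.X

/-!
The Galois group acts on the forest of backward orbits of the critical points `b j`, and the product
of iterated wreath products is the group of all automorphisms of this forest. The action is all of
it as soon as every transposition of two points of the same fibre of `f` can be realized at each
level, fixing all other points of that level.

For integer parameters this follows from conditions modulo squares of auxiliary primes `p` that do
not ramify in `K`. If `f` is Eisenstein at `p` and `b j ≡ 0` modulo `p ^ 2`, then inertia is
transitive on each level over `b j`. If `f ≡ X ^ (d - 1) * (X - c)` modulo `p` instead, then inertia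
fixes a point of some fibre and is transitive on the rest of it. Finally, if `p` divides
`f ^ (m + 1) (b j) - b j` exactly once, and no other difference between one of the first `m + 1`
iterates of a critical point and a critical point, then inertia contains a transposition at level
`m + 1`, and conjugation gives all the others over `b j`. Such primes exist for the models
`x ^ d - d B x ^ (d - 1) + c`, and by the Chinese remainder theorem the local conditions hold on a
residue class of integer parameters, whose points with distinct coordinates are Zariski dense.
-/

/-- The leaves of the complete rooted `d`-ary tree of height `n`, each encoded by the sequence of
edges leading to it from the root. -/
def TreePath (d : ℕ) : ℕ → Type
  | 0 => Unit
  | n + 1 => Fin d × TreePath d n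

namespace TreePath

variable {d : ℕ}

/-- `Agree n k u v` says that the leaves `u` and `v` have the same ancestor `k` levels above them.
When `n ≤ k` this ancestor would be the root or lie above it, and any two leaves agree. -/
def Agree : (n k : ℕ) → TreePath d n → TreePath d n → Prop
  | 0, _, _, _ => True
  | n + 1, k, u, v => n + 1 ≤ k ∨ (u.1 = v.1 ∧ Agree n k u.2 v.2)

theorem agree_of_le : ∀ {n k : ℕ} (_ : n ≤ k) (u v : TreePath d n), Agree n k u v
  | 0, _, _, _, _ => trivial
  | _ + 1, _, h, _, _ => Or.inl h

instance finite : ∀ n, Finite (TreePath d n)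
  | 0 => inferInstanceAs (Finite Unit)
  | n + 1 => by
    have := finite n
    exact inferInstanceAs (Finite (Fin d × TreePath d n))

instance nonempty [NeZero d] : ∀ n, Nonempty (TreePath d n)
  | 0 => inferInstanceAs (Nonempty Unit)
  | n + 1 => by
    have := nonempty n
    exact inferInstanceAs (Nonempty (Fin d × TreePath d n))

end TreePath

namespace SymWreath

variable {d : ℕ} {G : Type} [Group G] {P : Type*}

/-- The permutation of `Fin d × P` given by an element of the wreath product `S_d[G]`, where `G`
acts on `P`. -/
def toPerm (φ : G →* Equiv.Perm P) (w : SymWreath d G) : Equiv.Perm (Fin d × P) where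
  toFun u := (w.right u.1, φ (w.left (w.right u.1)) u.2)
  invFun u := (w.right⁻¹ u.1, (φ (w.left u.1))⁻¹ u.2)
  left_inv u := by simp
  right_inv u := by simp

/-- The imprimitive action of the wreath product `S_d[G]` on `Fin d × P`, where `G` acts on `P`. -/
def toPermHom (φ : G →* Equiv.Perm P) : SymWreath d G →* Equiv.Perm (Fin d × P) :=
  MonoidHom.mk' (toPerm φ) fun w w' => by
    have hs (i : Fin d) : mulAutArrow w.right w'.left (w.right i) = w'.left i := by
      change w'.left (w.right⁻¹ • w.right i) = _
      simp
    ext u <;> simp [toPerm, hs]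

theorem toPermHom_apply (φ : G →* Equiv.Perm P) (w : SymWreath d G) (i : Fin d) (u : P) :
    toPermHom φ w (i, u) = (w.right i, φ (w.left (w.right i)) u) := rfl

theorem toPermHom_injective [Nonempty P] {φ : G →* Equiv.Perm P} (hφ : Function.Injective φ) :
    Function.Injective (toPermHom (d := d) φ) := by
  intro w w' h
  have hright : w.right = w'.right := by
    ext i
    obtain ⟨u⟩ := ‹Nonempty P›
    have := congrArg (fun π => (π (i, u)).1) h
    simpa [toPermHom_apply] using congrArg Fin.val this
  refine SemidirectProduct.ext (funext fun i => hφ (Equiv.ext fun u => ?_)) hright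
  have := congrArg (fun π => (π (w.right⁻¹ i, u)).2) h
  simpa [toPermHom_apply, ← hright] using this

end SymWreath

/-- The action of the iterated wreath product `[S_d]^n` on the leaves of the tree of height `n`. -/
def iteratedSymWreathPerm (d : ℕ) : (n : ℕ) → (iteratedSymWreath d n →* Equiv.Perm (TreePath d n))
  | 0 => 1
  | n + 1 => SymWreath.toPermHom (iteratedSymWreathPerm d n)

theorem iteratedSymWreathPerm_injective (d : ℕ) [NeZero d] :
    ∀ n, Function.Injective (iteratedSymWreathPerm d n)
  | 0 => fun _ _ _ => (rfl : (() : Unit) = ())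
  | n + 1 => SymWreath.toPermHom_injective (iteratedSymWreathPerm_injective d n)

theorem TreePath.Agree.iteratedSymWreathPerm {d : ℕ} : ∀ {n k : ℕ} {u v : TreePath d n}
    (_ : Agree n k u v) (w : iteratedSymWreath d n),
      Agree n k (iteratedSymWreathPerm d n w u) (iteratedSymWreathPerm d n w v)
  | 0, _, _, _, _, _ => trivial
  | _ + 1, _, _, _, Or.inl h, _ => Or.inl h
  | _ + 1, _, (i, _), (j, _), Or.inr ⟨hij, h⟩, _ => by
    obtain rfl : i = j := hij
    exact Or.inr ⟨rfl, h.iteratedSymWreathPerm _⟩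

theorem exists_perm_prod_eq {α P : Type*} [Finite α] [Finite P] [Nonempty P]
    (π : Equiv.Perm (α × P)) (hπ : ∀ i u v, (π (i, u)).1 = (π (i, v)).1) :
    ∃ (τ : Equiv.Perm α) (ρ : α → Equiv.Perm P), ∀ i u, π (i, u) = (τ i, ρ i u) := by
  obtain ⟨u₀⟩ := ‹Nonempty P›
  have hτ : Function.Surjective fun i => (π (i, u₀)).1 := fun i => by
    obtain ⟨⟨j, v⟩, hj⟩ := π.surjective (i, u₀)
    exact ⟨j, (hπ j u₀ v).trans (congrArg Prod.fst hj)⟩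
  have hρ (i : α) : Function.Injective fun u => (π (i, u)).2 := fun u v h =>
    congrArg Prod.snd (π.injective (Prod.ext (hπ i u v) h))
  exact ⟨Equiv.ofBijective _ (Finite.surjective_iff_bijective.mp hτ),
    fun i => Equiv.ofBijective _ (Finite.injective_iff_bijective.mp (hρ i)),
    fun i u => Prod.ext (hπ i u u₀) rfl⟩

theorem mem_range_iteratedSymWreathPerm (d : ℕ) [NeZero d] : ∀ (n : ℕ)
    (π : Equiv.Perm (TreePath d n)),
    (∀ k u v, TreePath.Agree n k u v → TreePath.Agree n k (π u) (π v)) →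
      π ∈ (iteratedSymWreathPerm d n).range
  | 0, _, _ => ⟨1, Equiv.ext fun _ => (rfl : (() : Unit) = ())⟩
  | n + 1, π, hπ => by
    obtain ⟨τ, ρ, hτρ⟩ := exists_perm_prod_eq (α := Fin d) (P := TreePath d n) π fun i u v =>
      ((hπ n (i, u) (i, v) (Or.inr ⟨rfl, TreePath.agree_of_le le_rfl _ _⟩)).resolve_left
        (by omega)).1
    have hρ (i : Fin d) : ρ i ∈ (iteratedSymWreathPerm d n).range := by
      refine mem_range_iteratedSymWreathPerm d n _ fun k u v h => ?_
      rcases hπ k (i, u) (i, v) (Or.inr ⟨rfl, h⟩) with hk | ⟨-, huv⟩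
      · exact TreePath.agree_of_le (by omega) _ _
      · have hsnd (u : TreePath d n) : (π (i, u)).2 = ρ i u := congrArg Prod.snd (hτρ i u)
        rwa [hsnd, hsnd] at huv
    choose w hw using hρ
    refine ⟨(⟨fun i => w (τ⁻¹ i), τ⟩ : SymWreath d (iteratedSymWreath d n)), Equiv.ext ?_⟩
    rintro ⟨i, u⟩
    refine ((SymWreath.toPermHom_apply _ _ i u).trans ?_).trans (hτρ i u).symm
    simp [hw]

section Labelling

variable {X : Type*} {F : X → X} {d n : ℕ} {y : X}

theorem iterate_eq_iterate_of_le (F : X → X) {k n : ℕ} (hk : k ≤ n) {x x' : X}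
    (h : F^[k] x = F^[k] x') : F^[n] x = F^[n] x' := by
  obtain ⟨m, rfl⟩ := Nat.exists_eq_add_of_le' hk
  rw [Function.iterate_add_apply, h, Function.iterate_add_apply]

/-- A bijection of the leaves of the tree with the `n`-th preimages of `y` under `F` is a labelling
if the tree formed by the successive preimages of `y` corresponds to the abstract tree. -/
def IsTreeLabelling (l : TreePath d n ≃ {x // F^[n] x = y}) : Prop :=
  ∀ k ≤ n, ∀ u v, TreePath.Agree n k u v ↔ F^[k] (l u) = F^[k] (l v)

/-- The `(n + 1)`-st preimages of `y`, sorted by the preimage of `y` above which they lie. -/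
def sigmaPreimageEquiv (F : X → X) (n : ℕ) (y : X) :
    (Σ z : {z // F z = y}, {x // F^[n] x = z}) ≃ {x // F^[n + 1] x = y} where
  toFun p := ⟨p.2, by rw [Function.iterate_succ_apply', p.2.2, p.1.2]⟩
  invFun x := ⟨⟨F^[n] x, by rw [← Function.iterate_succ_apply' F, x.2]⟩, ⟨x, rfl⟩⟩
  left_inv := by
    rintro ⟨⟨z, hz⟩, ⟨x, hx⟩⟩
    obtain rfl : F^[n] x = z := hx
    rfl
  right_inv _ := rfl

/-- Labellings of the `n`-th preimages of the points of `F ⁻¹' {y}` glue to one of the `(n + 1)`-st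
preimages of `y`. -/
def consLabelling (c : Fin d ≃ {z // F z = y})
    (l : ∀ i, TreePath d n ≃ {x // F^[n] x = c i}) :
    TreePath d (n + 1) ≃ {x // F^[n + 1] x = y} :=
  (Equiv.sigmaEquivProd (Fin d) (TreePath d n)).symm.trans
    ((Equiv.sigmaCongr c l).trans (sigmaPreimageEquiv F n y))

theorem IsTreeLabelling.cons {c : Fin d ≃ {z // F z = y}}
    {l : ∀ i, TreePath d n ≃ {x // F^[n] x = c i}} (hl : ∀ i, IsTreeLabelling (l i)) :
    IsTreeLabelling (consLabelling c l) := by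
  rintro k hk ⟨i, u⟩ ⟨j, v⟩
  change (n + 1 ≤ k ∨ (i = j ∧ TreePath.Agree n k u v)) ↔ F^[k] (l i u : X) = F^[k] (l j v : X)
  rcases hk.eq_or_lt with rfl | hk
  · refine iff_of_true (Or.inl le_rfl) ?_
    simp only [Function.iterate_succ_apply', (l _ _).2, (c _).2]
  rw [or_iff_right (by omega)]
  refine ⟨fun ⟨hij, h⟩ => by subst hij; exact (hl i k (by omega) u v).mp h, fun h => ?_⟩
  have hij : i = j := c.injective <| Subtype.ext <| by
    rw [← (l i u).2, ← (l j v).2, iterate_eq_iterate_of_le F (by omega) h]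
  subst hij
  exact ⟨rfl, (hl i k (by omega) u v).mpr h⟩

theorem exists_isTreeLabelling [NeZero d] : ∀ (n : ℕ) (y : X),
    (∀ k < n, ∀ z, F^[k] z = y → Nat.card {x // F x = z} = d) →
      ∃ l : TreePath d n ≃ {x // F^[n] x = y}, IsTreeLabelling l
  | 0, y, _ => ⟨⟨fun _ => ⟨y, rfl⟩, fun _ => (), fun _ => rfl, fun x => Subtype.ext x.2.symm⟩,
      fun _ _ _ _ => ⟨fun _ => rfl, fun _ => trivial⟩⟩
  | n + 1, y, hcard => by
    have hy : Nat.card {x // F x = y} = d := hcard 0 n.succ_pos y rfl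
    have : Finite {x // F x = y} := Nat.finite_of_card_ne_zero (hy ▸ NeZero.ne d)
    obtain ⟨c⟩ : Nonempty (Fin d ≃ {x // F x = y}) := ⟨(Finite.equivFinOfCardEq hy).symm⟩
    have hsub (i : Fin d) : ∃ l : TreePath d n ≃ {x // F^[n] x = (c i : X)}, IsTreeLabelling l :=
      exists_isTreeLabelling n (c i) fun k hk z hz => hcard (k + 1) (by omega) z (by
        rw [Function.iterate_succ_apply', hz, (c i).2])
    choose l hl using hsub
    exact ⟨consLabelling c l, .cons hl⟩

end Labelling

section Swaps

variable {G T Y : Type*} [Group G] [MulAction G T]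

open Classical in
/-- The group `G` realizes the transposition of `x` and `x'` if one of its elements permutes `T` by
this transposition. -/
def RealizesSwap (G : Type*) {T : Type*} [Group G] [MulAction G T] (x x' : T) : Prop :=
  Equiv.swap x x' ∈ (MulAction.toPermHom G T).range

theorem RealizesSwap.refl (G : Type*) {T : Type*} [Group G] [MulAction G T] (x : T) :
    RealizesSwap G x x := by
  classical
  rw [RealizesSwap, Equiv.swap_self]
  exact one_mem _

theorem RealizesSwap.of_smul {σ : G} {x x' : T} (hx : σ • x = x') (hx' : σ • x' = x)
    (hfix : ∀ z, z ≠ x → z ≠ x' → σ • z = z) : RealizesSwap G x x' := by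
  classical
  refine ⟨σ, Equiv.ext fun z => ?_⟩
  rw [MulAction.toPermHom_apply, MulAction.toPerm_apply, Equiv.swap_apply_def]
  split_ifs with h h'
  exacts [h ▸ hx, h' ▸ hx', hfix z h h']

theorem RealizesSwap.smul {x x' : T} (h : RealizesSwap G x x') (σ : G) :
    RealizesSwap G (σ • x) (σ • x') := by
  classical
  have hσ : MulAction.toPermHom G T σ ∈ (MulAction.toPermHom G T).range := ⟨σ, rfl⟩
  have := mul_mem (mul_mem hσ h) (inv_mem hσ)
  rwa [← Equiv.swap_apply_apply] at this

/-- Conjugation moves a single transposition to any other one within a fibre of `F`. -/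
theorem RealizesSwap.of_stabilizer_transitive [MulAction G Y] {F : T →[G] Y} {x₀ x₁ x₂ : T}
    (h : RealizesSwap G x₁ x₂) (hne : x₁ ≠ x₂) (h₁₂ : F x₁ = F x₂)
    (hx₁ : x₀ ∈ MulAction.orbit G x₁)
    (hstab : ∀ a a', a ≠ x₀ → a' ≠ x₀ → F a = F x₀ → F a' = F x₀ →
      ∃ τ : G, τ • x₀ = x₀ ∧ τ • a = a')
    {x x' : T} (hx : x ∈ MulAction.orbit G x₀) (hxx' : F x = F x') : RealizesSwap G x x' := by
  by_cases hne' : x = x'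
  · exact hne' ▸ .refl G x
  obtain ⟨α, rfl⟩ := hx₁
  obtain ⟨β, rfl⟩ := hx
  dsimp only at *
  obtain ⟨τ, hτ₀, hτ⟩ := hstab (α • x₂) (β⁻¹ • x') (fun h => hne (smul_left_cancel α h).symm)
    (fun h => hne' (by rw [← h, smul_inv_smul])) (by rw [map_smul, map_smul, h₁₂])
    (by rw [map_smul, ← hxx', map_smul, inv_smul_smul])
  have hswap := ((h.smul α).smul τ).smul β
  rwa [hτ₀, hτ, smul_inv_smul] at hswap

open Classical in
theorem mem_of_forall_swap_mem [Finite T] {H : Subgroup (Equiv.Perm T)} {F : T → Y}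
    (hH : ∀ x x', F x = F x' → Equiv.swap x x' ∈ H) {ρ : Equiv.Perm T} (hρ : ∀ z, F (ρ z) = F z) :
    ρ ∈ H := by
  let S : Set (Equiv.Perm T) := {τ | ∃ x x', x ≠ x' ∧ F x = F x' ∧ τ = Equiv.swap x x'}
  have hS : ∀ τ ∈ S, τ.IsSwap := fun τ ⟨x, x', h, _, hτ⟩ => ⟨x, x', h, hτ⟩
  have hSH : Subgroup.closure S ≤ H := by
    rw [Subgroup.closure_le]
    rintro _ ⟨x, x', -, hF, rfl⟩
    exact hH x x' hF
  refine hSH ((mem_closure_isSwap hS).mpr ⟨Set.toFinite _, fun z => ?_⟩)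
  by_cases hz : ρ z = z
  · rw [hz]
    exact MulAction.mem_orbit_self _
  · exact ⟨⟨Equiv.swap z (ρ z), Subgroup.subset_closure
      ⟨z, ρ z, Ne.symm hz, (hρ z).symm, rfl⟩⟩, Equiv.swap_apply_left z (ρ z)⟩

theorem exists_perm_semiconj {S : Type*} [Finite T] {q : S → T} (hq : Function.Surjective q)
    (π : Equiv.Perm S) (hπ : ∀ x x', q x = q x' → q (π x) = q (π x')) :
    ∃ ρ : Equiv.Perm T, ∀ x, ρ (q x) = q (π x) := by
  have hr (x : S) : q (π (Function.surjInv hq (q x))) = q (π x) :=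
    hπ _ _ (Function.surjInv_eq hq _)
  have hsurj : Function.Surjective fun z => q (π (Function.surjInv hq z)) := fun z => by
    obtain ⟨x, rfl⟩ := hq z
    exact ⟨q (π.symm x), (hr _).trans (by rw [π.apply_symm_apply])⟩
  exact ⟨Equiv.ofBijective _ (Finite.surjective_iff_bijective.mp hsurj), hr⟩

end Swaps

section Forest

variable {G X ι : Type*} [Group G] [MulAction G X]

theorem iterate_smul (F : X →[G] X) (σ : G) (k : ℕ) (x : X) : F^[k] (σ • x) = σ • F^[k] x :=
  Function.Commute.iterate_left (fun x => map_smul F σ x) k x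

/-- The `k`-th preimages under an equivariant map `F` of a fixed point `y`. -/
def iterateFiber (F : X →[G] X) (k : ℕ) (y : MulAction.fixedPoints G X) : SubMulAction G X where
  carrier := {x | F^[k] x = y}
  smul_mem' σ x (hx : F^[k] x = y) := show F^[k] (σ • x) = y by rw [iterate_smul, hx, y.2]

/-- The `k`-th level of the forest formed by the iterated preimages of the fixed points `b j`. -/
def backwardLevel (F : X →[G] X) (b : ι → MulAction.fixedPoints G X) (k : ℕ) :
    SubMulAction G X where
  carrier := {x | ∃ j, F^[k] x = b j}
  smul_mem' σ _ := fun ⟨j, hj⟩ => ⟨j, (iterateFiber F k (b j)).smul_mem σ hj⟩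

variable {F : X →[G] X} {b : ι → MulAction.fixedPoints G X}

/-- The map `F ^ m` from a level of the forest to the one `m` levels below it. -/
def iterateLevel (F : X →[G] X) (b : ι → MulAction.fixedPoints G X) (k m : ℕ)
    (x : backwardLevel F b (k + m)) : backwardLevel F b k :=
  ⟨F^[m] x, x.2.imp fun _ hj => (Function.iterate_add_apply F k m x).symm.trans hj⟩

theorem iterateLevel_surjective {k : ℕ} : ∀ {m : ℕ},
    (∀ l < k + m, ∀ z ∈ backwardLevel F b l, ∃ x, F x = z) →
      Function.Surjective (iterateLevel F b k m)
  | 0, _, z => ⟨z, rfl⟩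
  | m + 1, hsurj, z => by
    obtain ⟨⟨y, hy⟩, rfl⟩ := iterateLevel_surjective (m := m) (fun l hl => hsurj l (by omega)) z
    obtain ⟨x, rfl⟩ := hsurj (k + m) (by omega) y hy
    exact ⟨⟨x, hy⟩, rfl⟩

theorem exists_iterate_smul_eq {k m : ℕ} [Finite (backwardLevel F b (m + 1 + k))]
    (hsurj : ∀ l < m + 1 + k, ∀ z ∈ backwardLevel F b l, ∃ x, F x = z)
    (hswap : ∀ x x' : backwardLevel F b (m + 1), F x = F x' → RealizesSwap G x x')
    (π : Equiv.Perm (backwardLevel F b (m + 1 + k)))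
    (hπ : ∀ x x' : backwardLevel F b (m + 1 + k), F^[k] x = F^[k] x' → F^[k] (π x) = F^[k] (π x'))
    (hπs : ∀ x, F^[k + 1] (π x) = F^[k + 1] x) :
    ∃ σ : G, ∀ x : backwardLevel F b (m + 1 + k), F^[k] (σ • (x : X)) = F^[k] (π x) := by
  classical
  have hq := iterateLevel_surjective hsurj
  have : Finite (backwardLevel F b (m + 1)) := .of_surjective _ hq
  obtain ⟨ρ, hρ⟩ := exists_perm_semiconj hq π fun x x' h =>
    Subtype.ext (hπ x x' (congrArg Subtype.val h))
  obtain ⟨σ, hσ⟩ : ρ ∈ (MulAction.toPermHom G (backwardLevel F b (m + 1))).range := by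
    refine mem_of_forall_swap_mem (F := fun z : backwardLevel F b (m + 1) => F z) hswap fun z => ?_
    obtain ⟨x, rfl⟩ := hq z
    rw [hρ]
    simpa only [iterateLevel, ← Function.iterate_succ_apply' F] using hπs x
  refine ⟨σ, fun x => ?_⟩
  rw [iterate_smul]
  have := hρ x
  rw [← hσ] at this
  exact congrArg Subtype.val this

/-- The element is built level by level from the roots upwards: once it is correct on a level, it
can be corrected on the next one by a permutation preserving the fibres of `F`. -/
theorem exists_smul_eq_of_realizesSwap {n : ℕ} [Finite (backwardLevel F b n)]
    (hsurj : ∀ k < n, ∀ z ∈ backwardLevel F b k, ∃ x, F x = z)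
    (hswap : ∀ k < n, ∀ x x' : backwardLevel F b (k + 1), F x = F x' → RealizesSwap G x x')
    (π : Equiv.Perm (backwardLevel F b n)) (hπ₀ : ∀ x, F^[n] (π x) = F^[n] x)
    (hπ : ∀ k ≤ n, ∀ x x' : backwardLevel F b n,
      F^[k] x = F^[k] x' → F^[k] (π x) = F^[k] (π x')) :
    ∃ σ : G, ∀ x : backwardLevel F b n, σ • (x : X) = π x := by
  suffices H : ∀ m k, m + k = n → ∃ σ : G, ∀ x : backwardLevel F b n,
      F^[k] (σ • (x : X)) = F^[k] (π x) from H n 0 rfl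
  intro m
  induction m with
  | zero => exact fun k hk => ⟨1, fun x => by
      rw [one_smul, (zero_add k).symm.trans hk, hπ₀]⟩
  | succ m ih =>
    rintro k rfl
    obtain ⟨σ, hσ⟩ := ih (k + 1) (by omega)
    let π' : Equiv.Perm (backwardLevel F b (m + 1 + k)) := π.trans (MulAction.toPerm σ⁻¹)
    have hπ' (l : ℕ) (x : backwardLevel F b (m + 1 + k)) : F^[l] (π' x) = σ⁻¹ • F^[l] (π x) :=
      iterate_smul F σ⁻¹ l _
    obtain ⟨τ, hτ⟩ := exists_iterate_smul_eq hsurj (hswap m (by omega)) π'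
      (fun x x' h => by rw [hπ', hπ', hπ k (by omega) x x' h])
      (fun x => by rw [hπ', ← hσ, iterate_smul, inv_smul_smul])
    exact ⟨σ * τ, fun x => by rw [mul_smul, iterate_smul, hτ, hπ', smul_inv_smul]⟩

/-- The `k`-th level of the forest, sorted by trees. -/
noncomputable def sigmaIterateFiberEquiv (hb : Function.Injective b) (k : ℕ) :
    (Σ j, iterateFiber F k (b j)) ≃ backwardLevel F b k :=
  Equiv.ofBijective (fun x => ⟨x.2, x.1, x.2.2⟩) <| by
    refine ⟨?_, fun ⟨x, j, hx⟩ => ⟨⟨j, x, hx⟩, rfl⟩⟩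
    rintro ⟨i, x, hx⟩ ⟨j, x', hx'⟩ h
    obtain rfl : x = x' := congrArg Subtype.val h
    obtain rfl : i = j := hb (Subtype.ext (Eq.trans (Eq.symm hx) hx'))
    rfl

theorem exists_smul_eq_of_forall_iterateFiber (hb : Function.Injective b) {n : ℕ}
    [Finite (backwardLevel F b n)]
    (hsurj : ∀ k < n, ∀ z ∈ backwardLevel F b k, ∃ x, F x = z)
    (hswap : ∀ k < n, ∀ x x' : backwardLevel F b (k + 1), F x = F x' → RealizesSwap G x x')
    (π : ∀ j, Equiv.Perm (iterateFiber F n (b j)))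
    (hπ : ∀ j, ∀ k ≤ n, ∀ x x' : iterateFiber F n (b j),
      F^[k] x = F^[k] x' → F^[k] (π j x) = F^[k] (π j x')) :
    ∃ σ : G, ∀ j (x : iterateFiber F n (b j)), σ • x = π j x := by
  let e := sigmaIterateFiberEquiv (F := F) hb n
  have he (j) (x : iterateFiber F n (b j)) : (e.permCongr (.sigmaCongrRight π) (e ⟨j, x⟩) : X) =
      π j x := by
    rw [Equiv.permCongr_apply, e.symm_apply_apply]
    rfl
  have hπ₀ (x) : F^[n] (e.permCongr (.sigmaCongrRight π) x : X) = F^[n] x := by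
    obtain ⟨⟨j, x⟩, rfl⟩ := e.surjective x
    rw [he]
    exact (π j x).2.trans (Eq.symm x.2)
  obtain ⟨σ, hσ⟩ := exists_smul_eq_of_realizesSwap hsurj hswap _ hπ₀ fun k hk x x' h => by
    obtain ⟨⟨i, x⟩, rfl⟩ := e.surjective x
    obtain ⟨⟨j, x'⟩, rfl⟩ := e.surjective x'
    obtain rfl : i = j := hb <| Subtype.ext <|
      (Eq.symm x.2).trans ((iterate_eq_iterate_of_le F hk h).trans x'.2)
    rw [he, he]
    exact hπ i k hk x x' h
  exact ⟨σ, fun j x => Subtype.ext ((hσ (e ⟨j, x⟩)).trans (he j x))⟩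

theorem IsTreeLabelling.permCongr_symm_mem_range_iff {F : X → X} {d n : ℕ} [NeZero d] {y : X}
    {l : TreePath d n ≃ {x // F^[n] x = y}} (hl : IsTreeLabelling l)
    (π : Equiv.Perm {x // F^[n] x = y}) :
    l.symm.permCongr π ∈ (iteratedSymWreathPerm d n).range ↔
      ∀ k ≤ n, ∀ x x' : {x // F^[n] x = y}, F^[k] x = F^[k] x' → F^[k] (π x) = F^[k] (π x') := by
  refine ⟨?_, fun hπ => mem_range_iteratedSymWreathPerm d n _ fun k u v h => ?_⟩
  · rintro ⟨w, hw⟩ k hk x x' h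
    have hπ (u) : π (l u) = l (iteratedSymWreathPerm d n w u) := by
      rw [hw, Equiv.permCongr_apply, Equiv.symm_symm, l.apply_symm_apply]
    obtain ⟨u, rfl⟩ := l.surjective x
    obtain ⟨v, rfl⟩ := l.surjective x'
    rw [hπ, hπ, ← hl k hk]
    exact ((hl k hk u v).mpr h).iteratedSymWreathPerm w
  · rcases le_total k n with hk | hk
    · rw [hl k hk] at h ⊢
      simpa only [Equiv.permCongr_apply, Equiv.symm_symm, Equiv.apply_symm_apply] using
        hπ k hk _ _ h
    · exact TreePath.agree_of_le hk _ _

/-- The action on the `n`-th preimages of the fixed points `b j`, transported to the leaves of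
abstract trees by bijections `l j`. -/
def leafPermHom {P : ι → Type*} {n : ℕ} (l : ∀ j, P j ≃ iterateFiber F n (b j)) :
    G →* (∀ j, Equiv.Perm (P j)) :=
  MonoidHom.pi fun j =>
    (l j).symm.permCongrHom.toMonoidHom.comp (MulAction.toPermHom G (iterateFiber F n (b j)))

theorem leafPermHom_injective {P : ι → Type*} {n : ℕ} [FaithfulSMul G (backwardLevel F b n)]
    (l : ∀ j, P j ≃ iterateFiber F n (b j)) : Function.Injective (leafPermHom l) := fun σ τ h => by
  refine eq_of_smul_eq_smul (α := backwardLevel F b n) fun ⟨x, j, hx⟩ => ?_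
  have hj : MulAction.toPerm σ = (MulAction.toPerm τ : Equiv.Perm (iterateFiber F n (b j))) :=
    (l j).symm.permCongrHom.injective (congrFun h j)
  have hx' : σ • x = τ • x := congrArg Subtype.val (Equiv.congr_fun hj ⟨x, hx⟩)
  exact Subtype.ext hx'

theorem mem_range_leafPermHom_iff {d n : ℕ} [NeZero d] (hb : Function.Injective b)
    [Finite (backwardLevel F b n)] (hsurj : ∀ k < n, ∀ z ∈ backwardLevel F b k, ∃ x, F x = z)
    (hswap : ∀ k < n, ∀ x x' : backwardLevel F b (k + 1), F x = F x' → RealizesSwap G x x')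
    {l : ∀ j, TreePath d n ≃ iterateFiber F n (b j)}
    (hl : ∀ j, IsTreeLabelling (F := F) (y := b j) (l j)) (π : ι → Equiv.Perm (TreePath d n)) :
    π ∈ (leafPermHom l).range ↔ ∀ j, π j ∈ (iteratedSymWreathPerm d n).range := by
  refine ⟨?_, fun hπ => ?_⟩
  · rintro ⟨σ, rfl⟩ j
    exact ((hl j).permCongr_symm_mem_range_iff _).mpr fun k _ x x' h =>
      (iterate_smul F σ k x).trans (h ▸ (iterate_smul F σ k x').symm)
  · obtain ⟨σ, hσ⟩ := exists_smul_eq_of_forall_iterateFiber hb hsurj hswap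
      (fun j => (l j).permCongr (π j)) fun j => ((hl j).permCongr_symm_mem_range_iff _).mp <|
        (hπ j).imp fun _ hw => hw.trans ((l j).permCongr.symm_apply_apply _).symm
    refine ⟨σ, funext fun j => Equiv.ext fun u => ?_⟩
    refine ((l j).symm_apply_eq).mpr ((hσ j (l j u)).trans (congrArg (l j) ?_))
    exact congrArg (π j) ((l j).symm_apply_apply u)

theorem nonempty_mulEquiv_iteratedSymWreath [Finite ι] (hb : Function.Injective b) {d n : ℕ}
    [NeZero d] (hcard : ∀ k < n, ∀ z ∈ backwardLevel F b k, Nat.card {x // F x = z} = d)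
    (hswap : ∀ k < n, ∀ x x' : backwardLevel F b (k + 1), F x = F x' → RealizesSwap G x x')
    [FaithfulSMul G (backwardLevel F b n)] :
    Nonempty (G ≃* (ι → iteratedSymWreath d n)) := by
  have hsurj (k) (hk : k < n) (z) (hz : z ∈ backwardLevel F b k) : ∃ x, F x = z :=
    have : Nat.card {x // F x = z} ≠ 0 := by rw [hcard k hk z hz]; exact NeZero.ne d
    (Nat.card_ne_zero.mp this).1.elim fun x => ⟨x.1, x.2⟩
  have hlab (j) : ∃ l : TreePath d n ≃ iterateFiber F n (b j),
      IsTreeLabelling (F := F) (y := b j) l :=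
    exists_isTreeLabelling n (b j : X) fun k hk z hz => hcard k hk z ⟨j, hz⟩
  choose l hl using hlab
  have : Finite (backwardLevel F b n) :=
    .of_equiv _ ((Equiv.sigmaCongrRight l).trans (sigmaIterateFiberEquiv hb n))
  let B : (ι → iteratedSymWreath d n) →* (ι → Equiv.Perm (TreePath d n)) :=
    MonoidHom.pi fun j => (iteratedSymWreathPerm d n).comp (Pi.evalMonoidHom _ j)
  have hB : Function.Injective B := fun w w' h =>
    funext fun j => iteratedSymWreathPerm_injective d n (congrFun h j)
  have hrange : (leafPermHom l).range = B.range := by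
    ext π
    rw [mem_range_leafPermHom_iff hb hsurj hswap hl, MonoidHom.mem_range]
    simp only [MonoidHom.mem_range, funext_iff, B]
    exact Classical.skolem
  exact ⟨(MonoidHom.ofInjective (leafPermHom_injective l)).trans
    ((MulEquiv.subgroupCongr hrange).trans (MonoidHom.ofInjective hB).symm)⟩

end Forest

section Iterates

open Polynomial

variable {R A : Type*} [CommRing R] [CommRing A] [Algebra R A]

theorem aeval_iterate_comp (f : R[X]) (k : ℕ) (x : A) :
    aeval x (f.comp^[k] X) = (aeval · f)^[k] x := by
  rw [aeval_def, iterate_comp_eval₂, eval₂_X]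
  rfl

theorem aeval_iterate_comp_sub_C (f : R[X]) (k : ℕ) (a : R) (x : A) :
    aeval x (f.comp^[k] X - C a) = (aeval · f)^[k] x - algebraMap R A a := by
  rw [map_sub, aeval_iterate_comp, aeval_C]

theorem iterate_comp_add (f : R[X]) (k m : ℕ) :
    f.comp^[k + m] X = (f.comp^[k] X).comp (f.comp^[m] X) := by
  induction k with
  | zero => simp
  | succ k ih =>
    rw [Nat.add_right_comm, Function.iterate_succ_apply', ih, Function.iterate_succ_apply',
      comp_assoc]

theorem iterate_comp_succ (f : R[X]) (k : ℕ) : f.comp^[k + 1] X = (f.comp^[k] X).comp f := by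
  simpa using iterate_comp_add f k 1

theorem derivative_iterate_comp_succ (f : R[X]) (k : ℕ) :
    derivative (f.comp^[k + 1] X) = derivative f * (derivative (f.comp^[k] X)).comp f := by
  rw [iterate_comp_succ, derivative_comp]

theorem exists_aeval_derivative_eq_zero [IsDomain A] (f : R[X]) (k : ℕ) (x : A)
    (h : aeval x (derivative (f.comp^[k] X)) = 0) :
    ∃ s < k, aeval ((aeval · f)^[s] x) (derivative f) = 0 := by
  induction k generalizing x with
  | zero => simp at h
  | succ k ih =>
    rw [derivative_iterate_comp_succ, map_mul, aeval_comp, mul_eq_zero] at h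
    rcases h with h | h
    · exact ⟨0, k.succ_pos, h⟩
    · obtain ⟨s, hs, h⟩ := ih _ h
      exact ⟨s + 1, by omega, h⟩

theorem monic_iterate_comp {f : R[X]} (hf : f.Monic) (hd : f.natDegree ≠ 0) (k : ℕ) :
    (f.comp^[k] X).Monic := by
  induction k with
  | zero => exact monic_X
  | succ k ih =>
    rw [iterate_comp_succ]
    exact ih.comp hf hd

variable [IsDomain R]

theorem natDegree_iterate_comp_X (f : R[X]) (k : ℕ) :
    (f.comp^[k] X).natDegree = f.natDegree ^ k := by
  rw [natDegree_iterate_comp, natDegree_X, mul_one]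

theorem monic_iterate_comp_sub_C {f : R[X]} (hf : f.Monic) (hd : f.natDegree ≠ 0) (k : ℕ)
    (a : R) : (f.comp^[k] X - C a).Monic := by
  refine (monic_iterate_comp hf hd k).sub_of_left (degree_C_le.trans_lt ?_)
  rw [← natDegree_pos_iff_degree_pos, natDegree_iterate_comp_X]
  exact pow_pos (Nat.pos_of_ne_zero hd) k

end Iterates

section Reduction

open Polynomial

variable {B κ : Type*} [CommRing B] [CommRing κ] (φ : B →+* κ)

theorem map_aeval_int (f : ℤ[X]) (x : B) : φ (aeval x f) = aeval (φ x) f :=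
  (aeval_algHom_apply φ.toIntAlgHom x f).symm

theorem map_iterate_aeval_int (f : ℤ[X]) (k : ℕ) (x : B) :
    φ ((aeval · f)^[k] x) = (aeval · f)^[k] (φ x) := by
  rw [← aeval_iterate_comp, ← aeval_iterate_comp, map_aeval_int]

theorem map_map_algebraMap_int (P : ℤ[X]) :
    (P.map (algebraMap ℤ B)).map φ = P.map (algebraMap ℤ κ) := by
  rw [Polynomial.map_map, RingHom.ext_int (φ.comp _)]

theorem aeval_intCast (f : ℤ[X]) (a : ℤ) : aeval (a : κ) f = (f.eval a : ℤ) := by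
  rw [aeval_def, eval₂_at_intCast, eq_intCast, Int.cast_id]

theorem iterate_aeval_intCast (f : ℤ[X]) (k : ℕ) (a : ℤ) :
    (aeval · f)^[k] (a : κ) = ((f.eval ·)^[k] a : ℤ) := by
  induction k with
  | zero => rfl
  | succ k ih => rw [Function.iterate_succ_apply', Function.iterate_succ_apply', ih, aeval_intCast]

theorem prod_X_sub_C_dvd_map [IsDomain B] {P : B[X]} (hP : P ≠ 0) {s : Finset B}
    (hs : ∀ x ∈ s, P.IsRoot x) : ∏ x ∈ s, (X - C (φ x)) ∣ P.map φ := by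
  have hdvd : ∏ x ∈ s, (X - C x) ∣ P := by
    refine (Multiset.prod_X_sub_C_dvd_iff_le_roots hP _).mpr ?_
    exact (Multiset.le_iff_subset s.nodup).mpr fun x hx => (mem_roots hP).mpr (hs x hx)
  simpa [Polynomial.map_prod] using Polynomial.map_dvd φ hdvd

theorem prod_X_sub_C_dvd_map_iterate_comp_sub_C [IsDomain B] {f : ℤ[X]} (hf : f.Monic)
    (hd : f.natDegree ≠ 0) {k : ℕ} {a : ℤ} {s : Finset B}
    (hs : ∀ x ∈ s, (aeval · f)^[k] x = (a : B)) :
    ∏ x ∈ s, (X - C (φ x)) ∣ (f.comp^[k] X - C a).map (algebraMap ℤ κ) := by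
  rw [← map_map_algebraMap_int φ]
  refine prod_X_sub_C_dvd_map φ ((monic_iterate_comp_sub_C hf hd k a).map _).ne_zero
    fun x hx => ?_
  rw [IsRoot, eval_map_algebraMap, aeval_iterate_comp_sub_C, hs x hx, eq_intCast, sub_self]

theorem prod_X_sub_C_dvd_map_sub_C [IsDomain B] {f : ℤ[X]} (hf : f.Monic)
    (hd : f.natDegree ≠ 0) {y : B} {s : Finset B} (hs : ∀ x ∈ s, aeval x f = y) :
    ∏ x ∈ s, (X - C (φ x)) ∣ f.map (algebraMap ℤ κ) - C (φ y) := by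
  have hmonic : (f.map (algebraMap ℤ B) - C y).Monic := by
    refine (hf.map _).sub_of_left (degree_C_le.trans_lt ?_)
    rw [hf.degree_map, ← natDegree_pos_iff_degree_pos]
    exact Nat.pos_of_ne_zero hd
  rw [← map_map_algebraMap_int φ, ← map_C, ← Polynomial.map_sub]
  refine prod_X_sub_C_dvd_map φ hmonic.ne_zero fun x hx => ?_
  rw [IsRoot, eval_sub, eval_map_algebraMap, hs x hx, eval_C, sub_self]

theorem finite_setOf_iterate_aeval_eq [IsDomain B] {f : ℤ[X]} (hf : f.Monic)
    (hd : f.natDegree ≠ 0) (k : ℕ) (a : ℤ) : {x : B | (aeval · f)^[k] x = a}.Finite := by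
  classical
  refine (((f.comp^[k] X - C a).map (algebraMap ℤ B)).roots.toFinset.finite_toSet).subset
    fun x hx => ?_
  rw [Finset.mem_coe, Multiset.mem_toFinset,
    mem_roots ((monic_iterate_comp_sub_C hf hd k a).map _).ne_zero, IsRoot, eval_map_algebraMap,
    aeval_iterate_comp_sub_C, hx, eq_intCast, sub_self]

theorem exists_aeval_eq_zero_of_splits [IsDomain B] [IsDomain κ] {P : ℤ[X]} (hP : P.Monic)
    (hs : (P.map (algebraMap ℤ B)).Splits) {r : B} (hr : aeval (φ r) P = 0) :
    ∃ x : B, aeval x P = 0 ∧ φ x = φ r := by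
  rw [← map_aeval_int, ← eval_map_algebraMap, hs.eval_eq_prod_roots_of_monic (hP.map _),
    map_multiset_prod, Multiset.prod_eq_zero_iff, Multiset.map_map, Multiset.mem_map] at hr
  obtain ⟨x, hx, hxr⟩ := hr
  rw [mem_roots (hP.map _).ne_zero, IsRoot, eval_map_algebraMap] at hx
  exact ⟨x, hx, (sub_eq_zero.mp ((map_sub φ r x).symm.trans hxr)).symm⟩

theorem exists_iterate_eq_of_splits [IsDomain B] [IsDomain κ] {f : ℤ[X]} (hf : f.Monic)
    (hd : f.natDegree ≠ 0) {k : ℕ} {a : ℤ}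
    (hs : ((f.comp^[k] X - C a).map (algebraMap ℤ B)).Splits) {r : B}
    (hr : (aeval · f)^[k] (φ r) = a) : ∃ x : B, (aeval · f)^[k] x = a ∧ φ x = φ r := by
  obtain ⟨x, hx, hxr⟩ := exists_aeval_eq_zero_of_splits φ (monic_iterate_comp_sub_C hf hd k a) hs
    (r := r) (by rw [aeval_iterate_comp_sub_C, hr, eq_intCast, sub_self])
  rw [aeval_iterate_comp_sub_C, eq_intCast, sub_eq_zero] at hx
  exact ⟨x, hx, hxr⟩

variable (G : Type*) [Group G] [MulSemiringAction G B]

/-- Evaluation of an integer polynomial, as an equivariant map for a group acting by ring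
automorphisms. -/
noncomputable def aevalActionHom (f : ℤ[X]) : B →[G] B :=
  ⟨(aeval · f), fun σ x => aeval_smul f σ x⟩

theorem smul_intCast {G : Type*} [Group G] [MulSemiringAction G B] (σ : G) (a : ℤ) :
    σ • (a : B) = a :=
  map_intCast (MulSemiringAction.toRingHom G B σ) a

/-- An integer as a fixed point of a group acting by ring automorphisms. -/
def intFixedPoint (a : ℤ) : MulAction.fixedPoints G B := ⟨a, fun σ => smul_intCast σ a⟩

theorem iterate_aeval_smul_eq {f : ℤ[X]} {k : ℕ} {a : ℤ} {x : B}
    (hx : (aeval · f)^[k] x = a) (σ : G) : (aeval · f)^[k] (σ • x) = a :=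
  (iterate_smul (aevalActionHom G f) σ k x).trans ((congrArg _ hx).trans (smul_intCast σ a))

end Reduction

/-- The integer polynomial `f` is monic of degree `d > 1`, and its critical points, listed with
multiplicity, are the integers `b i`. -/
structure HasCriticalPoints {ι : Type*} [Fintype ι] (f : Polynomial ℤ) (d : ℕ) (b : ι → ℤ) :
    Prop where
  one_lt : 1 < d
  monic : f.Monic
  natDegree_eq : f.natDegree = d
  derivative_eq : f.derivative = .C (d : ℤ) * ∏ i, (.X - .C (b i))

namespace HasCriticalPoints

open Polynomial

variable {ι : Type*} [Fintype ι] {f : ℤ[X]} {d : ℕ} {b : ι → ℤ}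

theorem natDegree_ne_zero (hf : HasCriticalPoints f d b) : f.natDegree ≠ 0 := by
  have := hf.one_lt
  have := hf.natDegree_eq
  omega

theorem eval_derivative (hf : HasCriticalPoints f d b) (j : ι) :
    (derivative f).eval (b j) = 0 := by
  rw [hf.derivative_eq, eval_mul, eval_prod, Finset.prod_eq_zero (Finset.mem_univ j) (by simp),
    mul_zero]

variable {κ : Type*} [CommRing κ] [IsDomain κ]

theorem exists_eq_of_aeval_derivative (hf : HasCriticalPoints f d b) (hd : (d : κ) ≠ 0) {z : κ}
    (hz : aeval z (derivative f) = 0) : ∃ i, z = b i := by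
  rw [hf.derivative_eq, map_mul, map_prod, mul_eq_zero] at hz
  obtain ⟨i, -, hi⟩ := Finset.prod_eq_zero_iff.mp (hz.resolve_left (by simp [hd]))
  exact ⟨i, sub_eq_zero.mp (by simpa using hi)⟩

theorem aeval_derivative_derivative_ne_zero (hf : HasCriticalPoints f d b) (hd : (d : κ) ≠ 0)
    {j : ι} (hj : ∀ i, i ≠ j → (b i : κ) ≠ b j) :
    aeval (b j : κ) (derivative (derivative f)) ≠ 0 := by
  classical
  have h : aeval (b j : κ) (derivative (derivative f)) =
      d * ∏ i ∈ Finset.univ.erase j, ((b j : κ) - b i) := by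
    rw [hf.derivative_eq, ← Finset.mul_prod_erase _ _ (Finset.mem_univ j)]
    simp [derivative_mul]
  rw [h]
  refine mul_ne_zero hd (Finset.prod_ne_zero_iff.mpr fun i hi => ?_)
  exact sub_ne_zero.mpr (hj i (Finset.ne_of_mem_erase hi)).symm

end HasCriticalPoints

section Inertia

open scoped Pointwise

variable {B : Type*} (G : Type*) [CommRing B] [Group G] [MulSemiringAction G B]

/-- The prime `Q` contains `p`, and `e` is both the order of `p` at `Q` and a lower bound for the
order at `Q` of the elements of `Q` fixed by inertia. For the ring of integers of a Galois
extension of number fields with group `G` this holds at every prime above `p` as soon as `p` is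
unramified in the base field, `e` being the ramification index. -/
structure IsUnramifiedBelowInertia (Q : Ideal B) (p e : ℕ) : Prop where
  natCast_mem : (p : B) ∈ Q
  mem_pow : ∀ x ∈ Q, (∀ σ ∈ Q.inertia G, σ • x = x) → x ∈ Q ^ e
  notMem_pow : (p : B) ∉ Q ^ (e + 1)

/-- Some nonzero prime of `B` satisfies `IsUnramifiedBelowInertia` at `p`. -/
def HasUnramifiedPrime (B : Type*) [CommRing B] [MulSemiringAction G B] (p : ℕ) : Prop :=
  ∃ (Q : Ideal B) (e : ℕ), Q.IsPrime ∧ Q ≠ ⊥ ∧ IsUnramifiedBelowInertia G Q p e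

variable {G}

/-- Working with a map to a domain rather than with the quotient by the prime keeps the
`ℤ`-algebra structure on the residue ring canonical. -/
theorem HasUnramifiedPrime.exists_ker {B : Type u} [CommRing B] [MulSemiringAction G B] {p : ℕ}
    (h : HasUnramifiedPrime G B p) :
    ∃ (κ : Type u) (_ : CommRing κ) (_ : IsDomain κ) (φ : B →+* κ) (e : ℕ),
      RingHom.ker φ ≠ ⊥ ∧ IsUnramifiedBelowInertia G (RingHom.ker φ) p e := by
  obtain ⟨Q, e, hQ, hQ0, h⟩ := h
  rw [← Ideal.mk_ker (I := Q)] at hQ0 h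
  exact ⟨B ⧸ Q, inferInstance, inferInstance, Ideal.Quotient.mk Q, e, hQ0, h⟩

namespace IsUnramifiedBelowInertia

variable {Q : Ideal B} {p e : ℕ}

theorem one_le (h : IsUnramifiedBelowInertia G Q p e) : 1 ≤ e := by
  rcases Nat.eq_zero_or_pos e with rfl | he
  · exact absurd (by simpa using h.natCast_mem) h.notMem_pow
  · exact he

theorem natCast_mem_pow (h : IsUnramifiedBelowInertia G Q p e) : (p : B) ∈ Q ^ e :=
  h.mem_pow _ h.natCast_mem fun σ _ => map_natCast (MulSemiringAction.toRingHom G B σ) p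

theorem charP {κ : Type*} [CommRing κ] [IsDomain κ] {φ : B →+* κ} (hp : p.Prime)
    (h : IsUnramifiedBelowInertia G (RingHom.ker φ) p e) : CharP κ p :=
  (CharP.charP_iff_prime_eq_zero hp).mpr ((map_natCast φ p).symm.trans h.natCast_mem)

end IsUnramifiedBelowInertia

theorem map_smul_of_mem_inertia {κ : Type*} [CommRing κ] {φ : B →+* κ} {σ : G}
    (hσ : σ ∈ (RingHom.ker φ).inertia G) (x : B) : φ (σ • x) = φ x :=
  sub_eq_zero.mp ((map_sub φ _ x).symm.trans (hσ x))

open Polynomial in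
/-- If `x` were fixed by inertia, then `x - a` would have order at least `e`, so the Taylor
expansion of `P` at its critical point `a` would give `P a` order at least `2 * e > e`. -/
theorem exists_mem_inertia_smul_ne {Q : Ideal B} [Q.IsPrime] {p e : ℕ}
    (hQ : IsUnramifiedBelowInertia G Q p e) [IsDedekindDomain B] {P : ℤ[X]} {a u : ℤ}
    (hder : (derivative P).eval a = 0) (hval : P.eval a = p * u) (hu : (u : B) ∉ Q) {x : B}
    (hx : aeval x P = 0) (hxa : x - a ∈ Q) : ∃ σ ∈ Q.inertia G, σ • x ≠ x := by
  by_contra! hfix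
  have hord : x - a ∈ Q ^ e :=
    hQ.mem_pow _ hxa fun σ hσ => by rw [smul_sub, hfix σ hσ, smul_intCast]
  obtain ⟨k, hk⟩ := binomExpansion (P.map (algebraMap ℤ B)) (a : B) (x - a)
  rw [derivative_map, eval_map_algebraMap, eval_map_algebraMap, eval_map_algebraMap,
    aeval_intCast, aeval_intCast, hder, hval, add_sub_cancel, hx] at hk
  push_cast at hk
  have hpu : (u : B) * p = -(k * (x - a) ^ 2) := by linear_combination -hk
  have hmem : (u : B) * p ∈ Q ^ (e + 1) := by
    have := hQ.one_le
    refine hpu ▸ neg_mem (Ideal.mul_mem_left _ _ ?_)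
    refine Ideal.pow_le_pow_right (show e + 1 ≤ e * 2 by omega) ?_
    exact pow_mul Q e 2 ▸ Ideal.pow_mem_pow hord 2
  rcases Ideal.IsPrime.mul_mem_pow Q hmem with h | h
  exacts [hu h, hQ.notMem_pow h]

end Inertia

/-- The local condition at `p` producing a transposition on the fibres at level `m + 1` over the
critical point `b j`: modulo `p` the only coincidence between the critical points and the first
`m + 1` points of their forward orbits is `f ^ (m + 1) (b j) = b j`, and this one fails modulo
`p ^ 2`. -/
structure TranspositionPrime {ι : Type*} (f : Polynomial ℤ) (b : ι → ℤ) (d m : ℕ) (j : ι)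
    (p : ℕ) : Prop where
  prime : p.Prime
  not_dvd : ¬ p ∣ d
  exists_val : ∃ u : ℤ, ¬ (p : ℤ) ∣ u ∧ (f.eval ·)^[m + 1] (b j) - b j = p * u
  simple : ∀ i, i ≠ j → ¬ (p : ℤ) ∣ b i - b j
  orbit : ∀ i j' k, 1 ≤ k → k ≤ m + 1 → (p : ℤ) ∣ (f.eval ·)^[k] (b i) - b j' →
    i = j ∧ j' = j ∧ k = m + 1

/-- A level of the backward orbits of the integers `b i` under the polynomial `f`. -/
noncomputable abbrev intBackwardLevel {ι : Type*} (G B : Type*) [CommRing B] [Group G]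
    [MulSemiringAction G B] (f : Polynomial ℤ) (b : ι → ℤ) (k : ℕ) : SubMulAction G B :=
  backwardLevel (aevalActionHom G f) (fun i => intFixedPoint G (b i)) k

namespace TranspositionPrime

open Polynomial

section Residue

variable {ι κ : Type*} {f : ℤ[X]} {b : ι → ℤ} {d m p : ℕ} {j : ι} [CommRing κ] [CharP κ p]

theorem natCast_degree_ne_zero (hT : TranspositionPrime f b d m j p) : (d : κ) ≠ 0 := fun h =>
  hT.not_dvd ((CharP.cast_eq_zero_iff κ p d).mp h)

theorem intCast_ne (hT : TranspositionPrime f b d m j p) (i : ι) (hi : i ≠ j) :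
    (b i : κ) ≠ b j := fun h =>
  hT.simple i hi ((CharP.intCast_eq_zero_iff κ p _).mp (by rw [Int.cast_sub, h, sub_self]))

theorem eq_of_iterate_aeval_eq (hT : TranspositionPrime f b d m j p) {i j' : ι} {k : ℕ}
    (hk : 1 ≤ k) (hkm : k ≤ m + 1) (h : (aeval · f)^[k] (b i : κ) = b j') :
    i = j ∧ j' = j ∧ k = m + 1 := by
  refine hT.orbit i j' k hk hkm ((CharP.intCast_eq_zero_iff κ p _).mp ?_)
  rw [Int.cast_sub, ← iterate_aeval_intCast, h, sub_self]

end Residue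

section CongruentRoots

variable {ι B κ : Type*} [Fintype ι] {f : ℤ[X]} {b : ι → ℤ} {d m p : ℕ} {j : ι} [CommRing B]
  [IsDomain B] [CommRing κ] [IsDomain κ] [CharP κ p] {φ : B →+* κ}

theorem eq_of_congruent_roots (hT : TranspositionPrime f b d m j p) (hf : HasCriticalPoints f d b)
    {k : ℕ} (hk : k ≤ m + 1) {j' : ι} {x x' : B} (hx : (aeval · f)^[k] x = b j')
    (hx' : (aeval · f)^[k] x' = b j') (hne : x ≠ x') (hxx' : φ x = φ x') :
    k = m + 1 ∧ j' = j ∧ φ x = b j := by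
  classical
  obtain ⟨r, hr⟩ := prod_X_sub_C_dvd_map_iterate_comp_sub_C φ hf.monic hf.natDegree_ne_zero
    (k := k) (a := b j') (s := {x, x'}) (by simp [hx, hx'])
  rw [Finset.prod_pair hne, ← hxx'] at hr
  have hder : aeval (φ x) (derivative (f.comp^[k] X)) = 0 := by
    have := congrArg (fun P => eval (φ x) (derivative P)) hr
    rw [derivative_map, eval_map_algebraMap] at this
    simpa using this
  obtain ⟨s, hs, hcrit⟩ := exists_aeval_derivative_eq_zero f k _ hder
  obtain ⟨i, hi⟩ := hf.exists_eq_of_aeval_derivative hT.natCast_degree_ne_zero hcrit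
  have hiter : (aeval · f)^[k - s] (b i : κ) = b j' := by
    rw [← hi, ← Function.iterate_add_apply, Nat.sub_add_cancel hs.le, ← map_iterate_aeval_int, hx,
      map_intCast]
  obtain ⟨rfl, rfl, hks⟩ := hT.eq_of_iterate_aeval_eq (by omega) (by omega) hiter
  obtain rfl : s = 0 := by omega
  exact ⟨by omega, rfl, hi⟩

theorem aeval_derivative_iterate_ne_zero (hT : TranspositionPrime f b d m j p)
    (hf : HasCriticalPoints f d b) :
    aeval (b j : κ) (derivative (derivative (f.comp^[m + 1] X))) ≠ 0 := by
  have hcrit : aeval (b j : κ) (derivative f) = 0 := by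
    rw [aeval_intCast, hf.eval_derivative, Int.cast_zero]
  have hd : (d : κ) ≠ 0 := hT.natCast_degree_ne_zero
  have hsecond := hf.aeval_derivative_derivative_ne_zero hd hT.intCast_ne
  rw [derivative_iterate_comp_succ, derivative_mul, map_add, map_mul, map_mul, hcrit, zero_mul,
    add_zero, aeval_comp]
  refine mul_ne_zero hsecond fun h => ?_
  obtain ⟨s, hs, h⟩ := exists_aeval_derivative_eq_zero f m _ h
  obtain ⟨i, hi⟩ := hf.exists_eq_of_aeval_derivative hd h
  rw [← Function.iterate_succ_apply (aeval · f)] at hi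
  obtain ⟨-, -, hsm⟩ := hT.eq_of_iterate_aeval_eq (by omega) (by omega) hi
  omega

theorem card_le_two_of_congruent_roots (hT : TranspositionPrime f b d m j p)
    (hf : HasCriticalPoints f d b) {s : Finset B} (hs : ∀ x ∈ s, (aeval · f)^[m + 1] x = b j)
    (hφ : ∀ x ∈ s, φ x = b j) : s.card ≤ 2 := by
  by_contra! hcard
  have hdvd := prod_X_sub_C_dvd_map_iterate_comp_sub_C φ hf.monic hf.natDegree_ne_zero hs
  rw [Finset.prod_congr rfl fun x hx => by rw [hφ x hx], Finset.prod_const] at hdvd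
  obtain ⟨r, hr⟩ := (pow_dvd_pow _ hcard).trans hdvd
  refine hT.aeval_derivative_iterate_ne_zero (κ := κ) hf ?_
  have := congrArg (fun P => eval (b j : κ) (derivative (derivative P))) hr
  rw [derivative_map, derivative_map, eval_map_algebraMap] at this
  simpa [derivative_mul, derivative_pow] using this

end CongruentRoots

section Swap

open scoped Pointwise

variable {B ι κ : Type*} {f : ℤ[X]} {b : ι → ℤ} {d m p : ℕ} {j : ι} [Fintype ι] [CommRing B]
  {G : Type*} [Group G] [MulSemiringAction G B]

theorem realizesSwap_smul [IsDomain B] [CommRing κ] [IsDomain κ] [CharP κ p] {φ : B →+* κ}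
    (hT : TranspositionPrime f b d m j p) (hf : HasCriticalPoints f d b) {σ : G}
    (hσ : σ ∈ (RingHom.ker φ).inertia G) {x : intBackwardLevel G B f b (m + 1)}
    (hx : (aeval · f)^[m + 1] (x : B) = b j) (hxφ : φ x = b j) (hσx : σ • (x : B) ≠ x) :
    RealizesSwap G x (σ • x) := by
  classical
  have hφ (z : B) : φ (σ • z) = φ z := map_smul_of_mem_inertia hσ z
  have hpair (z : B) (hz : (aeval · f)^[m + 1] z = b j) (hzφ : φ z = b j) :
      z = x ∨ z = σ • (x : B) := by
    by_contra! hne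
    have := hT.card_le_two_of_congruent_roots (φ := φ) hf (s := {z, (x : B), σ • (x : B)})
      (by
        simp only [Finset.forall_mem_insert, Finset.mem_singleton, forall_eq]
        exact ⟨hz, hx, iterate_aeval_smul_eq G hx σ⟩)
      (by simp [hzφ, hxφ, hφ])
    rw [Finset.card_eq_three.mpr ⟨_, _, _, hne.1, hne.2, hσx.symm, rfl⟩] at this
    omega
  refine .of_smul rfl (Subtype.ext ?_) fun z hzx hzσ => ?_
  · exact (hpair _ (iterate_aeval_smul_eq G (iterate_aeval_smul_eq G hx σ) σ)
      ((hφ _).trans ((hφ _).trans hxφ))).resolve_right fun h => hσx (smul_left_cancel σ h)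
  · by_contra hne
    obtain ⟨j', hz : (aeval · f)^[m + 1] (z : B) = b j'⟩ := z.2
    obtain ⟨-, rfl, hzφ⟩ := hT.eq_of_congruent_roots hf le_rfl hz (iterate_aeval_smul_eq G hz σ)
      (fun h => hne (Subtype.ext h.symm)) (hφ z).symm
    exact (hpair z hz hzφ).elim (fun h => hzx (Subtype.ext h)) fun h => hzσ (Subtype.ext h)

theorem exists_realizesSwap [IsDedekindDomain B] (hT : TranspositionPrime f b d m j p)
    (hf : HasCriticalPoints f d b) (hp : HasUnramifiedPrime G B p)
    (hs : ((f.comp^[m + 1] X - C (b j)).map (algebraMap ℤ B)).Splits) :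
    ∃ x₁ x₂ : intBackwardLevel G B f b (m + 1), (aeval · f)^[m + 1] (x₁ : B) = b j ∧ x₁ ≠ x₂ ∧
      aeval (x₁ : B) f = aeval (x₂ : B) f ∧ RealizesSwap G x₁ x₂ := by
  obtain ⟨κ, _, _, φ, e, -, hφ⟩ := hp.exists_ker
  have := hφ.charP hT.prime
  have := RingHom.ker_isPrime φ
  obtain ⟨u, hu, hval⟩ := hT.exists_val
  obtain ⟨x, hx, hxφ⟩ := exists_iterate_eq_of_splits φ hf.monic hf.natDegree_ne_zero hs
    (r := (b j : B)) (by
      rw [map_intCast, iterate_aeval_intCast, eq_add_of_sub_eq hval]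
      simp)
  obtain ⟨σ, hσ, hσx⟩ := exists_mem_inertia_smul_ne hφ (P := f.comp^[m + 1] X - C (b j)) (a := b j)
    (by rw [derivative_sub, derivative_C, sub_zero, derivative_iterate_comp_succ, eval_mul,
      hf.eval_derivative, zero_mul])
    (by simpa [iterate_comp_eval] using hval)
    (by rwa [RingHom.mem_ker, map_intCast, CharP.intCast_eq_zero_iff κ p])
    (by rw [aeval_iterate_comp_sub_C, hx, eq_intCast, sub_self])
    (by rw [RingHom.mem_ker, map_sub, hxφ, sub_self])
  let x₁ : intBackwardLevel G B f b (m + 1) := ⟨x, j, hx⟩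
  refine ⟨x₁, σ • x₁, hx, fun h => hσx (congrArg Subtype.val h).symm, ?_,
    hT.realizesSwap_smul hf hσ hx (hxφ.trans (map_intCast φ _)) hσx⟩
  by_contra hne
  have := hT.eq_of_congruent_roots hf (φ := φ) (k := m) (by omega) (j' := j) hx
    (iterate_aeval_smul_eq G hx σ) hne
    (by simp only [map_aeval_int, map_smul_of_mem_inertia hσ])
  omega

end Swap

end TranspositionPrime

section IdealVal

open scoped Pointwise

variable {B : Type*} [CommRing B] [IsDedekindDomain B] (Q : Ideal B)

/-- The order of vanishing of `x` at the ideal `Q`. -/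
noncomputable def idealVal (x : B) : ℕ∞ := emultiplicity Q (Ideal.span {x})

variable {Q}

theorem le_idealVal_iff {x : B} {n : ℕ} : (n : ℕ∞) ≤ idealVal Q x ↔ x ∈ Q ^ n := by
  rw [idealVal, ← pow_dvd_iff_le_emultiplicity, Ideal.dvd_iff_le, Ideal.span_singleton_le_iff_mem]

theorem idealVal_eq_iff {x : B} {n : ℕ} :
    idealVal Q x = n ↔ x ∈ Q ^ n ∧ x ∉ Q ^ (n + 1) := by
  rw [idealVal, emultiplicity_eq_coe, Ideal.dvd_iff_le, Ideal.span_singleton_le_iff_mem,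
    Ideal.dvd_iff_le, Ideal.span_singleton_le_iff_mem]

theorem one_le_idealVal_iff {x : B} : 1 ≤ idealVal Q x ↔ x ∈ Q := by
  simpa using le_idealVal_iff (Q := Q) (x := x) (n := 1)

theorem idealVal_eq_zero {x : B} (hx : x ∉ Q) : idealVal Q x = 0 := by
  simpa [hx] using idealVal_eq_iff (Q := Q) (x := x) (n := 0)

theorem idealVal_eq_of_sub_mem {x y : B} {n : ℕ} (hy : idealVal Q y = n)
    (h : x - y ∈ Q ^ (n + 1)) : idealVal Q x = n := by
  rw [idealVal_eq_iff] at hy ⊢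
  refine ⟨?_, fun hx => hy.2 (sub_sub_cancel x y ▸ sub_mem hx h)⟩
  exact sub_add_cancel x y ▸ add_mem (Ideal.pow_le_pow_right n.le_succ h) hy.1

theorem idealVal_smul_of_mem_inertia {G : Type*} [Group G] [MulSemiringAction G B] {σ : G}
    (hσ : σ ∈ Q.inertia G) (x : B) : idealVal Q (σ • x) = idealVal Q x := by
  refine ENat.eq_of_forall_natCast_le_iff fun n => ?_
  have hQ : σ • Q ^ n = Q ^ n := by rw [smul_pow', Ideal.inertia_le_stabilizer Q hσ]
  rw [le_idealVal_iff, le_idealVal_iff, ← Ideal.smul_mem_pointwise_smul_iff (a := σ) (x := x), hQ]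

variable [Q.IsPrime]

theorem idealVal_mul (hQ : Q ≠ ⊥) (x y : B) :
    idealVal Q (x * y) = idealVal Q x + idealVal Q y := by
  rw [idealVal, ← Ideal.span_singleton_mul_span_singleton,
    emultiplicity_mul (Ideal.prime_of_isPrime hQ ‹_›)]
  rfl

theorem idealVal_pow (hQ : Q ≠ ⊥) (x : B) (n : ℕ) : idealVal Q (x ^ n) = n * idealVal Q x := by
  rw [idealVal, ← Ideal.span_singleton_pow, emultiplicity_pow (Ideal.prime_of_isPrime hQ ‹_›)]
  rfl

theorem idealVal_prod (hQ : Q ≠ ⊥) {ι : Type*} (s : Finset ι) (x : ι → B) :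
    idealVal Q (∏ i ∈ s, x i) = ∑ i ∈ s, idealVal Q (x i) := by
  rw [idealVal, ← Ideal.prod_span_singleton,
    Finset.emultiplicity_prod (Ideal.prime_of_isPrime hQ ‹_›)]
  rfl

theorem exists_idealVal_eq_of_pow_mul (hQ : Q ≠ ⊥) {x y : B} {D n : ℕ} (hD : D ≠ 0) (hy : y ∉ Q)
    (h : idealVal Q (x ^ D * y) = n) : ∃ v : ℕ, idealVal Q x = v ∧ D * v = n := by
  rw [idealVal_mul hQ, idealVal_eq_zero hy, add_zero, idealVal_pow hQ] at h
  have hx : idealVal Q x ≠ ⊤ := fun hx => by simp [hx, ENat.mul_top, hD] at h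
  obtain ⟨v, hv⟩ := ENat.ne_top_iff_exists.mp hx
  exact ⟨v, hv.symm, by rw [← hv] at h; exact_mod_cast h⟩

end IdealVal

theorem smul_prod_orbit {H B : Type*} [Group H] [CommRing B] [MulSemiringAction H B] (x : B)
    [Fintype (MulAction.orbit H x)] (σ : H) :
    σ • ∏ y : MulAction.orbit H x, (y : B) = ∏ y : MulAction.orbit H x, (y : B) := by
  rw [Finset.smul_prod']
  exact Fintype.prod_equiv (MulAction.toPerm σ) _ _ fun _ => rfl

theorem IsUnramifiedBelowInertia.idealVal_natCast {G B : Type*} [Group G] [CommRing B]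
    [IsDedekindDomain B] [MulSemiringAction G B] {Q : Ideal B} {p e : ℕ}
    (h : IsUnramifiedBelowInertia G Q p e) : idealVal Q (p : B) = e :=
  idealVal_eq_iff.mpr ⟨h.natCast_mem_pow, h.notMem_pow⟩

theorem IsUnramifiedBelowInertia.intCast_mem_pow_succ {G B : Type*} [Group G] [CommRing B]
    [MulSemiringAction G B] {Q : Ideal B} {p e : ℕ} (h : IsUnramifiedBelowInertia G Q p e) {a : ℤ}
    (ha : (p : ℤ) ^ 2 ∣ a) : (a : B) ∈ Q ^ (e + 1) := by
  obtain ⟨c, rfl⟩ := ha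
  push_cast
  rw [pow_two, pow_succ]
  exact Ideal.mul_mem_right _ _ (Ideal.mul_mem_mul h.natCast_mem_pow h.natCast_mem)

/-- The polynomial `f` reduces to `X ^ D * g` modulo `p`, with `g` not vanishing at the origin, and
has the Newton polygon of an Eisenstein polynomial of degree `D` there; the origin is the reduction
of the integer `b`, which vanishes modulo `p ^ 2`. -/
structure EisensteinPrime (f g : Polynomial ℤ) (D : ℕ) (b : ℤ) (p : ℕ) : Prop where
  prime : p.Prime
  two_le : 2 ≤ D
  dvd_sub : .C (p : ℤ) ∣ f - .X ^ D * g
  not_dvd : ¬ (p : ℤ) ∣ g.coeff 0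
  sq_not_dvd : ¬ (p : ℤ) ^ 2 ∣ f.coeff 0
  sq_dvd : (p : ℤ) ^ 2 ∣ b

namespace EisensteinPrime

open Polynomial

variable {f g : ℤ[X]} {D p : ℕ} {b : ℤ}

theorem ne_zero (hE : EisensteinPrime f g D b p) : D ≠ 0 := by
  have := hE.two_le
  omega

theorem exists_eq_add (hE : EisensteinPrime f g D b p) :
    ∃ q : ℤ[X], f = X ^ D * g + C (p : ℤ) * q ∧ ¬ (p : ℤ) ∣ q.coeff 0 := by
  obtain ⟨q, hq⟩ := hE.dvd_sub
  have hf : f = X ^ D * g + C (p : ℤ) * q := (add_eq_of_eq_sub' hq.symm).symm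
  refine ⟨q, hf, fun hdvd => hE.sq_not_dvd ?_⟩
  rw [hf, coeff_add, mul_coeff_zero, coeff_X_pow, if_neg hE.ne_zero.symm, zero_mul, zero_add,
    coeff_C_mul, pow_two]
  exact mul_dvd_mul_left _ hdvd

variable {κ : Type*} [CommRing κ] [CharP κ p]

theorem intCast_eq_zero (hE : EisensteinPrime f g D b p) : (b : κ) = 0 :=
  (CharP.intCast_eq_zero_iff κ p b).mpr ((dvd_pow_self _ two_ne_zero).trans hE.sq_dvd)

theorem aeval_eq (hE : EisensteinPrime f g D b p) (x : κ) :
    aeval x f = x ^ D * aeval x g := by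
  obtain ⟨q, hq, -⟩ := hE.exists_eq_add
  rw [hq]
  simp

theorem map_eq (hE : EisensteinPrime f g D b p) :
    f.map (algebraMap ℤ κ) = X ^ D * g.map (algebraMap ℤ κ) := by
  obtain ⟨q, hq, -⟩ := hE.exists_eq_add
  rw [hq]
  simp

theorem iterate_aeval_zero (hE : EisensteinPrime f g D b p) (k : ℕ) :
    (aeval · f)^[k] (0 : κ) = 0 :=
  Function.iterate_fixed (by rw [hE.aeval_eq, zero_pow hE.ne_zero, zero_mul]) k

theorem exists_aeval_eq_sub (hE : EisensteinPrime f g D b p) {B : Type*} [CommRing B]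
    {φ : B →+* κ} {x : B} (hx : φ x = 0) :
    ∃ y z : B, aeval x f = x ^ D * y - p * z ∧ φ y ≠ 0 ∧ φ z ≠ 0 := by
  obtain ⟨q, hq, hq₀⟩ := hE.exists_eq_add
  have hne {r : ℤ[X]} (hr : ¬ (p : ℤ) ∣ r.coeff 0) : φ (aeval x r) ≠ 0 := by
    have h₀ : aeval (0 : κ) r = (r.coeff 0 : ℤ) := by
      simpa [coeff_zero_eq_eval_zero] using aeval_intCast (κ := κ) r 0
    rwa [map_aeval_int, hx, h₀, Ne, CharP.intCast_eq_zero_iff κ p]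
  refine ⟨aeval x g, -aeval x q, ?_, hne hE.not_dvd, by simpa using hne hq₀⟩
  rw [hq]
  simp

section Inertia

open scoped Pointwise

variable {B G : Type*} [CommRing B] [IsDedekindDomain B] [Group G] [MulSemiringAction G B]
  [IsDomain κ] {φ : B →+* κ} {e : ℕ}

/-- Going back one step along the orbit divides the order by `D`, since the order of `aeval x f` is
that of `x ^ D` as long as it is smaller than the order `e` of the constant term. -/
theorem exists_idealVal_mul_pow_eq (hE : EisensteinPrime f g D b p)
    (hφ : IsUnramifiedBelowInertia G (RingHom.ker φ) p e) (hQ : RingHom.ker φ ≠ ⊥) {k : ℕ} {x : B}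
    (hx : φ x = 0) (hxb : (aeval · f)^[k + 1] x = b) :
    ∃ v : ℕ, idealVal (RingHom.ker φ) x = v ∧ D ^ (k + 1) * v = e := by
  have := RingHom.ker_isPrime φ
  induction k generalizing x with
  | zero =>
    obtain ⟨y, z, hf, hy, hz⟩ := hE.exists_aeval_eq_sub hx
    have hpz : idealVal (RingHom.ker φ) (p * z) = e := by
      rw [idealVal_mul hQ, hφ.idealVal_natCast, idealVal_eq_zero hz, add_zero]
    have hxy : x ^ D * y - p * z ∈ RingHom.ker φ ^ (e + 1) := by
      rw [← hf, show aeval x f = b from hxb]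
      exact hφ.intCast_mem_pow_succ hE.sq_dvd
    rw [zero_add, pow_one]
    exact exists_idealVal_eq_of_pow_mul hQ hE.ne_zero hy (idealVal_eq_of_sub_mem hpz hxy)
  | succ k ih =>
    obtain ⟨y, z, hf, hy, -⟩ := hE.exists_aeval_eq_sub hx
    obtain ⟨v, hv, hve⟩ := ih (x := aeval x f)
      (by rw [map_aeval_int, hx, hE.aeval_eq, zero_pow hE.ne_zero, zero_mul]) hxb
    have hlt : v < e := by
      have hv₀ : v ≠ 0 := by
        rintro rfl
        exact absurd hφ.one_le (by omega)
      exact hve ▸ lt_mul_of_one_lt_left (Nat.pos_of_ne_zero hv₀)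
        (Nat.one_lt_pow k.succ_ne_zero hE.two_le)
    have hxy : x ^ D * y - aeval x f ∈ RingHom.ker φ ^ (v + 1) := by
      rw [hf, sub_sub_cancel]
      exact Ideal.mul_mem_right _ _ (Ideal.pow_le_pow_right hlt hφ.natCast_mem_pow)
    obtain ⟨w, hw, rfl⟩ :=
      exists_idealVal_eq_of_pow_mul hQ hE.ne_zero hy (idealVal_eq_of_sub_mem hv hxy)
    exact ⟨w, hw, by rw [pow_succ, mul_assoc, hve]⟩

/-- The product of the orbit is fixed by inertia, hence of order at least `e`, while each of its
factors has order `e / D ^ k`. -/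
theorem pow_le_card_orbit [Finite G] (hE : EisensteinPrime f g D b p)
    (hφ : IsUnramifiedBelowInertia G (RingHom.ker φ) p e) (hQ : RingHom.ker φ ≠ ⊥) {k : ℕ} {x : B}
    (hx : φ x = 0) (hxb : (aeval · f)^[k] x = b) :
    D ^ k ≤ Nat.card (MulAction.orbit ((RingHom.ker φ).inertia G) x) := by
  set I := (RingHom.ker φ).inertia G
  have : Finite (MulAction.orbit I x) := (Set.finite_range _).to_subtype
  have : Fintype (MulAction.orbit I x) := Fintype.ofFinite _
  have hmem : x ∈ MulAction.orbit I x := MulAction.mem_orbit_self x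
  rcases k with - | k
  · exact Nat.card_pos_iff.mpr ⟨⟨x, hmem⟩, inferInstance⟩
  have := RingHom.ker_isPrime φ
  obtain ⟨v, hv, hve⟩ := hE.exists_idealVal_mul_pow_eq hφ hQ hx hxb
  have hv₀ : 0 < v := by
    have := one_le_idealVal_iff.mpr (show x ∈ RingHom.ker φ from hx)
    rw [hv] at this
    exact_mod_cast this
  have hval : idealVal (RingHom.ker φ) (∏ y : MulAction.orbit I x, (y : B)) =
      (Nat.card (MulAction.orbit I x) * v : ℕ) := by
    rw [idealVal_prod hQ, Finset.sum_congr rfl (g := fun _ => (v : ℕ∞))]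
    · simp
    · rintro ⟨_, σ, rfl⟩ -
      exact (idealVal_smul_of_mem_inertia σ.2 x).trans hv
  have hprod : ∏ y : MulAction.orbit I x, (y : B) ∈ RingHom.ker φ ^ e :=
    hφ.mem_pow _ (Ideal.mem_of_dvd _ (Finset.dvd_prod_of_mem _ (Finset.mem_univ ⟨x, hmem⟩))
      (show x ∈ RingHom.ker φ from hx)) fun σ hσ => smul_prod_orbit x (⟨σ, hσ⟩ : I)
  rw [← le_idealVal_iff, hval, Nat.cast_le, ← hve] at hprod
  exact Nat.le_of_mul_le_mul_right hprod hv₀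

theorem exists_map_iterate_comp_eq (hE : EisensteinPrime f g D b p) (k : ℕ) :
    ∃ r : κ[X], (f.comp^[k] X).map (algebraMap ℤ κ) = X ^ D ^ k * r ∧ r.eval 0 ≠ 0 := by
  induction k with
  | zero => exact ⟨1, by simp, by simp⟩
  | succ k ih =>
    obtain ⟨r, hr, hr₀⟩ := ih
    refine ⟨r ^ D * (g.map (algebraMap ℤ κ)).comp (X ^ D ^ k * r), ?_, ?_⟩
    · rw [Function.iterate_succ_apply', Polynomial.map_comp, hE.map_eq, hr, mul_comp, X_pow_comp,
        mul_pow, ← pow_mul, ← pow_succ, mul_assoc]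
    · have hg : ((g.eval 0 : ℤ) : κ) ≠ 0 := by
        rw [← coeff_zero_eq_eval_zero, Ne, CharP.intCast_eq_zero_iff κ p]
        exact hE.not_dvd
      have h₀ : (0 : κ) ^ D ^ k = 0 := zero_pow (pow_ne_zero _ hE.ne_zero)
      simp [eval_comp, hr₀, hg, h₀]

theorem card_le_of_congruent_roots (hE : EisensteinPrime f g D b p) (hf : f.Monic)
    (hd : f.natDegree ≠ 0) {k : ℕ} {s : Finset B} (hs : ∀ x ∈ s, (aeval · f)^[k] x = b)
    (hφ : ∀ x ∈ s, φ x = 0) : s.card ≤ D ^ k := by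
  obtain ⟨r, hr, hr₀⟩ := hE.exists_map_iterate_comp_eq (κ := κ) k
  have hdvd := prod_X_sub_C_dvd_map_iterate_comp_sub_C φ hf hd hs
  rw [Finset.prod_congr rfl fun x hx => by rw [hφ x hx, C_0, sub_zero], Finset.prod_const,
    Polynomial.map_sub, hr, map_C, eq_intCast, hE.intCast_eq_zero, C_0, sub_zero] at hdvd
  by_contra! hlt
  have := (pow_dvd_pow X hlt).trans hdvd
  rw [pow_succ, mul_dvd_mul_iff_left (pow_ne_zero _ X_ne_zero), X_dvd_iff,
    coeff_zero_eq_eval_zero] at this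
  exact hr₀ this

theorem orbit_inertia_eq [Finite G] (hE : EisensteinPrime f g D b p) (hf : f.Monic)
    (hd : f.natDegree ≠ 0) (hφ : IsUnramifiedBelowInertia G (RingHom.ker φ) p e)
    (hQ : RingHom.ker φ ≠ ⊥) {k : ℕ} {x : B} (hx : φ x = 0) (hxb : (aeval · f)^[k] x = b) :
    MulAction.orbit ((RingHom.ker φ).inertia G) x =
      {x' : B | (aeval · f)^[k] x' = b ∧ φ x' = 0} := by
  have hfin : {x' : B | (aeval · f)^[k] x' = b ∧ φ x' = 0}.Finite :=
    (finite_setOf_iterate_aeval_eq hf hd k b).subset fun _ h => h.1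
  refine Set.eq_of_subset_of_ncard_le ?_ (le_trans ?_ (hE.pow_le_card_orbit hφ hQ hx hxb)) hfin
  · rintro _ ⟨σ, rfl⟩
    exact ⟨iterate_aeval_smul_eq G hxb σ, (map_smul_of_mem_inertia σ.2 x).trans hx⟩
  · rw [Set.ncard_eq_toFinset_card _ hfin]
    exact hE.card_le_of_congruent_roots (φ := φ) hf hd (fun x hx => ((hfin.mem_toFinset).mp hx).1)
      fun x hx => ((hfin.mem_toFinset).mp hx).2

theorem exists_iterate_eq (hE : EisensteinPrime f g D b p) (hf : f.Monic) (hd : f.natDegree ≠ 0)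
    {k : ℕ} (hs : ((f.comp^[k] X - C b).map (algebraMap ℤ B)).Splits) :
    ∃ x : B, (aeval · f)^[k] x = b ∧ φ x = 0 := by
  simpa using exists_iterate_eq_of_splits φ hf hd hs (r := 0)
    (by rw [map_zero, hE.iterate_aeval_zero, hE.intCast_eq_zero])

end Inertia

section TotallyRamified

theorem eq_zero_of_iterate_aeval_eq_zero [IsDomain κ] (hE : EisensteinPrime f 1 D b p) {k : ℕ}
    {z : κ} (hz : (aeval · f)^[k] z = 0) : z = 0 := by
  induction k generalizing z with
  | zero => exact hz
  | succ k ih => simpa [hE.aeval_eq, hE.ne_zero] using ih hz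

theorem map_eq_zero_of_iterate_eq [IsDomain κ] (hE : EisensteinPrime f 1 D b p) {B : Type*}
    [CommRing B] {φ : B →+* κ} {k : ℕ} {x : B} (hxb : (aeval · f)^[k] x = b) : φ x = 0 := by
  refine hE.eq_zero_of_iterate_aeval_eq_zero (k := k) ?_
  rw [← map_iterate_aeval_int, hxb, map_intCast, hE.intCast_eq_zero]

variable {B G : Type*} [CommRing B] [IsDedekindDomain B] [Group G] [MulSemiringAction G B]
  {k : ℕ}

theorem mem_orbit_of_iterate_eq [Finite G] (hE : EisensteinPrime f 1 D b p) (hf : f.Monic)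
    (hd : f.natDegree ≠ 0) (hp : HasUnramifiedPrime G B p) {x x' : B} (hx : (aeval · f)^[k] x = b)
    (hx' : (aeval · f)^[k] x' = b) : x' ∈ MulAction.orbit G x := by
  obtain ⟨κ, _, _, φ, e, hQ, hφ⟩ := hp.exists_ker
  have := hφ.charP hE.prime
  obtain ⟨σ, hσ⟩ := (hE.orbit_inertia_eq hf hd hφ hQ (hE.map_eq_zero_of_iterate_eq hx) hx).ge
    (show _ ∧ φ x' = 0 from ⟨hx', hE.map_eq_zero_of_iterate_eq hx'⟩)
  exact ⟨σ, hσ⟩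

theorem card_iterate_eq [Finite G] (hE : EisensteinPrime f 1 D b p) (hf : f.Monic)
    (hD : f.natDegree = D) (hp : HasUnramifiedPrime G B p)
    (hs : ((f.comp^[k] X - C b).map (algebraMap ℤ B)).Splits) :
    Nat.card {x : B // (aeval · f)^[k] x = b} = D ^ k := by
  obtain ⟨κ, _, _, φ, e, hQ, hφ⟩ := hp.exists_ker
  have := hφ.charP hE.prime
  have hd : f.natDegree ≠ 0 := hD ▸ hE.ne_zero
  obtain ⟨x, hx, hxφ⟩ := hE.exists_iterate_eq (φ := φ) hf hd hs
  have hfin := finite_setOf_iterate_aeval_eq (B := B) hf hd k b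
  have horbit : MulAction.orbit ((RingHom.ker φ).inertia G) x =
      {x' : B | (aeval · f)^[k] x' = b} :=
    (hE.orbit_inertia_eq hf hd hφ hQ hxφ hx).trans
      (Set.ext fun _ => and_iff_left_of_imp hE.map_eq_zero_of_iterate_eq)
  have hmem (x : B) (h : x ∈ hfin.toFinset) : (aeval · f)^[k] x = b := hfin.mem_toFinset.mp h
  refine le_antisymm ?_ ((hE.pow_le_card_orbit hφ hQ hxφ hx).trans_eq
    (congrArg (fun s : Set B => Nat.card s) horbit))
  refine (Nat.card_coe_set_eq _).trans_le ((Set.ncard_eq_toFinset_card _ hfin).trans_le ?_)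
  exact hE.card_le_of_congruent_roots (φ := φ) hf hd hmem
    fun x hx => hE.map_eq_zero_of_iterate_eq (hmem x hx)

end TotallyRamified

end EisensteinPrime

namespace EisensteinPrime

open Polynomial

variable {f : ℤ[X]} {c b : ℤ} {D p : ℕ}

section Residue

variable {B κ : Type*} [CommRing B] [CommRing κ] [CharP κ p] {φ : B →+* κ}

theorem intCast_ne_zero (hE : EisensteinPrime f (X - C c) D b p) : (c : κ) ≠ 0 := by
  rw [Ne, CharP.intCast_eq_zero_iff κ p]
  simpa using hE.not_dvd

theorem prod_dvd [IsDomain B] (hE : EisensteinPrime f (X - C c) D b p) (hf : f.Monic)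
    (hd : f.natDegree ≠ 0) {y : B} (hy : φ y = 0) {s : Finset B} (hs : ∀ x ∈ s, aeval x f = y) :
    ∏ x ∈ s, (X - C (φ x)) ∣ X ^ D * (X - C (c : κ)) := by
  have hdvd := prod_X_sub_C_dvd_map_sub_C φ hf hd hs
  rwa [hE.map_eq, hy, C_0, sub_zero, Polynomial.map_sub, map_X, map_C, eq_intCast] at hdvd

variable [IsDomain κ]

theorem map_eq_zero_or_eq (hE : EisensteinPrime f (X - C c) D b p) {x : B}
    (hx : φ (aeval x f) = 0) : φ x = 0 ∨ φ x = c := by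
  rw [map_aeval_int, hE.aeval_eq, mul_eq_zero, map_sub, aeval_X, aeval_C, eq_intCast,
    sub_eq_zero] at hx
  exact hx.imp_left eq_zero_of_pow_eq_zero

variable [IsDomain B]

theorem eq_of_map_eq (hE : EisensteinPrime f (X - C c) D b p) (hf : f.Monic)
    (hd : f.natDegree ≠ 0) {x x' : B} (hx : φ (aeval x f) = 0) (hxx' : aeval x' f = aeval x f)
    (hxc : φ x = c) (hxc' : φ x' = c) : x = x' := by
  classical
  by_contra hne
  have hdvd := hE.prod_dvd hf hd hx (s := {x, x'}) (by simp [hxx'])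
  rw [Finset.prod_pair hne, hxc, hxc', mul_dvd_mul_iff_right (X_sub_C_ne_zero _), dvd_iff_isRoot,
    IsRoot, eval_pow, eval_X] at hdvd
  exact hE.intCast_ne_zero (eq_zero_of_pow_eq_zero hdvd)

theorem exists_aeval_eq_and_map_eq (hE : EisensteinPrime f (X - C c) D b p) (hf : f.Monic)
    (hd : f.natDegree ≠ 0) {y : B} (hy : φ y = 0)
    (hcard : Nat.card {x : B // aeval x f = y} = D + 1) : ∃ x : B, aeval x f = y ∧ φ x = c := by
  by_contra! hno
  have hfin : {x : B | aeval x f = y}.Finite :=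
    Set.finite_coe_iff.mp (Nat.finite_of_card_ne_zero (hcard.trans_ne D.succ_ne_zero))
  have hmem (x : B) (hx : x ∈ hfin.toFinset) : aeval x f = y := hfin.mem_toFinset.mp hx
  have hcard' : hfin.toFinset.card = D + 1 :=
    (Set.ncard_eq_toFinset_card _ hfin).symm.trans ((Nat.card_coe_set_eq _).symm.trans hcard)
  have hdvd := hE.prod_dvd hf hd hy hmem
  rw [Finset.prod_congr rfl fun x hx => by
      rw [(hE.map_eq_zero_or_eq ((hmem x hx).symm ▸ hy)).resolve_right (hno x (hmem x hx)), C_0,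
        sub_zero],
    Finset.prod_const, hcard', pow_succ, mul_dvd_mul_iff_left (pow_ne_zero _ X_ne_zero),
    X_dvd_iff] at hdvd
  exact hE.intCast_ne_zero (κ := κ) (by simpa using hdvd)

end Residue

/-- Over a point `y` of the fibre reducing to `0` there is exactly one point `x₀` reducing to `c`;
inertia fixes it and permutes the remaining ones, which all reduce to `0`, transitively. -/
theorem exists_stabilizer_transitive {B G : Type*} [CommRing B] [IsDedekindDomain B] [Group G]
    [MulSemiringAction G B] [Finite G] (hE : EisensteinPrime f (X - C c) D b p) (hf : f.Monic)
    (hd : f.natDegree ≠ 0) (hp : HasUnramifiedPrime G B p) {m : ℕ}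
    (hs : ((f.comp^[m] X - C b).map (algebraMap ℤ B)).Splits)
    (hcard : ∀ z : B, (aeval · f)^[m] z = b → Nat.card {x : B // aeval x f = z} = D + 1) :
    ∃ x₀ : B, (aeval · f)^[m + 1] x₀ = b ∧ ∀ a a' : B, a ≠ x₀ → a' ≠ x₀ →
      aeval a f = aeval x₀ f → aeval a' f = aeval x₀ f → ∃ τ : G, τ • x₀ = x₀ ∧ τ • a = a' := by
  obtain ⟨κ, _, _, φ, e, hQ, hφ⟩ := hp.exists_ker
  have := hφ.charP hE.prime
  obtain ⟨y, hy, hyφ⟩ := hE.exists_iterate_eq (φ := φ) hf hd hs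
  obtain ⟨x₀, rfl, hx₀c⟩ := hE.exists_aeval_eq_and_map_eq hf hd hyφ (hcard y hy)
  have hzero (a : B) (ha : a ≠ x₀) (hax : aeval a f = aeval x₀ f) : φ a = 0 :=
    (hE.map_eq_zero_or_eq (hax ▸ hyφ)).resolve_right fun hac =>
      ha (hE.eq_of_map_eq hf hd hyφ hax hx₀c hac).symm
  have hlevel (a : B) (hax : aeval a f = aeval x₀ f) : (aeval · f)^[m + 1] a = b := by
    rw [Function.iterate_succ_apply, hax, hy]
  refine ⟨x₀, hy, fun a a' ha ha' hax hax' => ?_⟩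
  obtain ⟨τ, rfl⟩ := (hE.orbit_inertia_eq hf hd hφ hQ (hzero a ha hax) (hlevel a hax)).ge
    (show _ ∧ φ a' = 0 from ⟨hlevel a' hax', hzero a' ha' hax'⟩)
  have hfix : aeval ((τ : G) • x₀) f = aeval x₀ f := by
    rw [aeval_smul, ← hax, ← aeval_smul, hax]
    exact hax'
  exact ⟨τ, (hE.eq_of_map_eq hf hd hyφ hfix hx₀c
    ((map_smul_of_mem_inertia τ.2 x₀).trans hx₀c)).symm, rfl⟩

end EisensteinPrime

theorem card_fiber_eq_of_transitive {G X : Type*} [Group G] [MulAction G X] (F : X →[G] X)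
    {d k : ℕ} {y z : X} (hd : d ≠ 0) (htrans : ∀ z', F^[k] z' = y → z' ∈ MulAction.orbit G z)
    (hk : Nat.card {x // F^[k] x = y} = d ^ k)
    (hk' : Nat.card {x // F^[k + 1] x = y} = d ^ (k + 1)) :
    Nat.card {x // F x = z} = d := by
  have hfib (z' : {x // F^[k] x = y}) : Nonempty ({x // F x = z'} ≃ {x // F x = z}) := by
    obtain ⟨σ, hσ⟩ := htrans z' z'.2
    refine ⟨(MulAction.toPerm σ⁻¹).subtypeEquiv fun x => ?_⟩
    rw [MulAction.toPerm_apply, map_smul, ← hσ, inv_smul_eq_iff]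
  have hsum : d ^ (k + 1) = d ^ k * Nat.card {x // F x = z} := by
    rw [← hk', ← hk, ← Nat.card_prod, ← Nat.card_congr (Equiv.sigmaSubtypeFiberEquivSubtype F
      (p := (F^[k + 1] · = y)) (q := (F^[k] · = y)) fun _ => Iff.rfl)]
    exact Nat.card_congr (Equiv.sigmaEquivProdOfEquiv fun z' => (hfib z').some)
  exact (Nat.eq_of_mul_eq_mul_left (pow_pos (Nat.pos_of_ne_zero hd) k) (hsum ▸ pow_succ d k)).symm

section LocalConditions

open Polynomial

variable {B G ι : Type*} [CommRing B] [IsDedekindDomain B] [Group G] [MulSemiringAction G B]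
  [Fintype ι] {f : ℤ[X]} {b : ι → ℤ} {d k p : ℕ} {j : ι}

theorem HasCriticalPoints.card_fiber_eq [Finite G] (hf : HasCriticalPoints f d b)
    (hp : HasUnramifiedPrime G B p) (hE : EisensteinPrime f 1 d (b j) p)
    (hs : ((f.comp^[k] X - C (b j)).map (algebraMap ℤ B)).Splits)
    (hs' : ((f.comp^[k + 1] X - C (b j)).map (algebraMap ℤ B)).Splits) {z : B}
    (hz : (aeval · f)^[k] z = b j) : Nat.card {x : B // aeval x f = z} = d :=
  card_fiber_eq_of_transitive (aevalActionHom G f) hE.ne_zero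
    (fun _ hz' => hE.mem_orbit_of_iterate_eq hf.monic hf.natDegree_ne_zero hp hz hz')
    (hE.card_iterate_eq hf.monic hf.natDegree_eq hp hs)
    (hE.card_iterate_eq hf.monic hf.natDegree_eq hp hs')

theorem exists_stabilizer_transitive_of_card_eq_two {X Y : Type*} (G : Type*) [Group G]
    [MulAction G X] {F : X → Y} {x₀ a a' : X} (hcard : Nat.card {x // F x = F x₀} = 2)
    (ha : a ≠ x₀) (ha' : a' ≠ x₀) (hax : F a = F x₀) (hax' : F a' = F x₀) :
    ∃ τ : G, τ • x₀ = x₀ ∧ τ • a = a' := by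
  obtain ⟨u, v, -, huv⟩ := Nat.card_eq_two_iff.mp hcard
  have hmem (x : X) (hx : F x = F x₀) : x = u ∨ x = v := by
    simpa [Subtype.ext_iff] using (huv ▸ Set.mem_univ (⟨x, hx⟩ : {x // F x = F x₀}) :)
  refine ⟨1, one_smul _ _, (one_smul _ _).trans ?_⟩
  grind

theorem realizesSwap_of_local_conditions [Finite G] (hf : HasCriticalPoints f d b)
    (hs : ((f.comp^[k] X - C (b j)).map (algebraMap ℤ B)).Splits)
    (hs' : ((f.comp^[k + 1] X - C (b j)).map (algebraMap ℤ B)).Splits)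
    (hE : ∃ p, HasUnramifiedPrime G B p ∧ EisensteinPrime f 1 d (b j) p)
    (hC : 3 ≤ d → ∃ p c, HasUnramifiedPrime G B p ∧ EisensteinPrime f (X - C c) (d - 1) (b j) p)
    (hT : ∃ p, HasUnramifiedPrime G B p ∧ TranspositionPrime f b d k j p)
    {x x' : intBackwardLevel G B f b (k + 1)} (hx : (aeval · f)^[k + 1] (x : B) = b j)
    (hxx' : aeval (x : B) f = aeval (x' : B) f) : RealizesSwap G x x' := by
  obtain ⟨p, hp, hE⟩ := hE
  obtain ⟨q, hq, hT⟩ := hT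
  have hcard (z : B) (hz : (aeval · f)^[k] z = b j) : Nat.card {x : B // aeval x f = z} = d :=
    hf.card_fiber_eq hp hE hs hs' hz
  obtain ⟨x₁, x₂, hx₁, hne, h₁₂, hswap⟩ := hT.exists_realizesSwap hf hq hs'
  obtain ⟨x₀, hx₀, hstab⟩ : ∃ x₀ : B, (aeval · f)^[k + 1] x₀ = b j ∧ ∀ a a' : B, a ≠ x₀ →
      a' ≠ x₀ → aeval a f = aeval x₀ f → aeval a' f = aeval x₀ f →
        ∃ τ : G, τ • x₀ = x₀ ∧ τ • a = a' := by
    rcases eq_or_lt_of_le (Nat.succ_le_of_lt hf.one_lt) with hd | hd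
    · exact ⟨x₁, hx₁, fun a a' =>
        exists_stabilizer_transitive_of_card_eq_two G ((hcard _ hx₁).trans hd.symm)⟩
    · obtain ⟨r, c, hr, hC⟩ := hC hd
      exact hC.exists_stabilizer_transitive hf.monic hf.natDegree_ne_zero hr hs
        fun z hz => (hcard z hz).trans (by omega)
  have horbit {y z : intBackwardLevel G B f b (k + 1)} (hy : (aeval · f)^[k + 1] (y : B) = b j)
      (hz : (aeval · f)^[k + 1] (z : B) = b j) : z ∈ MulAction.orbit G y := by
    obtain ⟨σ, hσ⟩ := hE.mem_orbit_of_iterate_eq hf.monic hf.natDegree_ne_zero hp hy hz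
    exact ⟨σ, Subtype.ext hσ⟩
  let root : intBackwardLevel G B f b (k + 1) := ⟨x₀, j, hx₀⟩
  refine RealizesSwap.of_stabilizer_transitive (x₀ := root)
    (F := (aevalActionHom G f).comp (SubMulAction.subtype _)) hswap hne h₁₂ (horbit hx₁ hx₀)
    (fun a a' ha ha' hax hax' => ?_) (horbit hx₀ hx) hxx'
  obtain ⟨τ, hτ, hτa⟩ := hstab a a' (fun h => ha (Subtype.ext h)) (fun h => ha' (Subtype.ext h))
    hax hax'
  exact ⟨τ, Subtype.ext hτ, Subtype.ext hτa⟩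

theorem nonempty_mulEquiv_of_local_conditions [Finite G] {n : ℕ} (hf : HasCriticalPoints f d b)
    (hb : Function.Injective fun i => (b i : B))
    (hs : ∀ k ≤ n, ∀ j, ((f.comp^[k] X - C (b j)).map (algebraMap ℤ B)).Splits)
    [FaithfulSMul G (intBackwardLevel G B f b n)]
    (hE : ∀ j, ∃ p, HasUnramifiedPrime G B p ∧ EisensteinPrime f 1 d (b j) p)
    (hC : 3 ≤ d → ∀ j, ∃ p c, HasUnramifiedPrime G B p ∧
      EisensteinPrime f (X - C c) (d - 1) (b j) p)
    (hT : ∀ k < n, ∀ j, ∃ p, HasUnramifiedPrime G B p ∧ TranspositionPrime f b d k j p) :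
    Nonempty (G ≃* (ι → iteratedSymWreath d n)) := by
  have : NeZero d := ⟨hf.natDegree_eq ▸ hf.natDegree_ne_zero⟩
  refine nonempty_mulEquiv_iteratedSymWreath (F := aevalActionHom G f)
    (b := fun i => intFixedPoint G (b i)) (fun i j h => hb (congrArg Subtype.val h)) ?_ ?_
  · rintro k hk z ⟨j, hz⟩
    obtain ⟨p, hp, hE⟩ := hE j
    exact hf.card_fiber_eq hp hE (hs k hk.le j) (hs (k + 1) hk j) hz
  · intro k hk x x' hxx'
    obtain ⟨j, hx⟩ := x.2
    exact realizesSwap_of_local_conditions hf (hs k hk.le j) (hs (k + 1) hk j) (hE j)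
      (fun hd => hC hd j) (hT k hk j) hx hxx'

end LocalConditions

section NumberField

open Polynomial
open scoped NumberField Pointwise

section Ramification

variable {L : Type*} [Field L] (Q : Ideal (𝓞 L)) [Q.IsMaximal] {p : ℕ}

theorem ramificationIdx_eq_of_not_dvd_discr (K : Type*) [Field K] [NumberField K] [Algebra K L]
    (hp : p.Prime) (hpK : ¬ (p : ℤ) ∣ NumberField.discr K) (hpQ : (p : 𝓞 L) ∈ Q) :
    Q.ramificationIdx ℤ = Q.ramificationIdx (𝓞 K) := by
  have : Algebra.IsUnramifiedAt ℤ (Q.under (𝓞 K)) :=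
    (NumberField.not_dvd_discr_iff_forall_mem K (𝓞 K) (Nat.prime_iff_prime_int.mp hp)).mp hpK _
      inferInstance (by simpa [Ideal.mem_comap] using hpQ)
  rw [Ideal.ramificationIdx_tower (R := ℤ) (Q.under (𝓞 K)) Q, Ideal.ramificationIdx_eq_one,
    one_mul]

variable [NumberField L]

theorem natCast_notMem_pow_ramificationIdx_succ (hp : p.Prime) (hpQ : (p : 𝓞 L) ∈ Q) :
    (p : 𝓞 L) ∉ Q ^ (Q.ramificationIdx ℤ + 1) := by
  have hpL : (p : 𝓞 L) ≠ 0 := by exact_mod_cast hp.ne_zero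
  have : Q.LiesOver (Ideal.span {(p : ℤ)}) := by
    rw [Ideal.liesOver_span_iff (Ideal.IsPrime.ne_top inferInstance)
      (Nat.prime_iff_prime_int.mp hp)]
    simpa using hpQ
  have hmap : (Ideal.span {(p : ℤ)}).map (algebraMap ℤ (𝓞 L)) = Ideal.span {(p : 𝓞 L)} := by
    simp [Ideal.map_span]
  have hspan : Ideal.span {(p : 𝓞 L)} ≠ ⊥ := by simpa using hp.ne_zero
  have hfin : FiniteMultiplicity Q (Ideal.span {(p : 𝓞 L)}) :=
    .of_prime_left (Ideal.prime_of_isPrime (by rintro rfl; exact hpL hpQ) inferInstance) hspan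
  rw [Ideal.IsDedekindDomain.ramificationIdx_eq_multiplicity (Ideal.span {(p : ℤ)}) Q
    (hmap ▸ hspan), hmap, ← Ideal.span_singleton_le_iff_mem, ← Ideal.dvd_iff_le]
  exact hfin.not_pow_dvd_of_multiplicity_lt (Nat.lt_succ_self _)

variable (K : Type*) [Field K] [NumberField K] [Algebra K L] [IsGalois K L]

theorem card_inertia_eq_ramificationIdx (hQ : Q ≠ ⊥) :
    Nat.card (Q.inertia Gal(L/K)) = Q.ramificationIdx (𝓞 K) := by
  have : IsGaloisGroup Gal(L/K) (𝓞 K) (𝓞 L) := .of_isFractionRing _ _ _ K L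
  have : (Q.under (𝓞 K)).IsMaximal := Ideal.IsMaximal.under (𝓞 K) Q
  have : Finite (𝓞 K ⧸ Q.under (𝓞 K)) := Ring.HasFiniteQuotients.finiteQuotient
    fun h => hQ (Ideal.eq_bot_of_comap_eq_bot (R := 𝓞 K) h)
  rw [Ideal.card_inertia_eq_ramificationIdxIn (G := Gal(L/K)) (Q.under (𝓞 K)) Q,
    Ideal.ramificationIdxIn_eq_ramificationIdx (Q.under (𝓞 K)) Q Gal(L/K)]

/-- Over the fixed field of the inertia group, `Q` is totally ramified with ramification index the
order of the inertia group. -/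
theorem mem_pow_card_inertia_of_fixed (hQ : Q ≠ ⊥) {x : 𝓞 L} (hxQ : x ∈ Q)
    (hx : ∀ σ ∈ Q.inertia Gal(L/K), σ • x = x) : x ∈ Q ^ Nat.card (Q.inertia Gal(L/K)) := by
  set I := Q.inertia Gal(L/K)
  let E : IntermediateField K L := FixedPoints.intermediateField I
  have : IsGaloisGroup I E L := IsGaloisGroup.subgroup Gal(L/K) K L I
  have : IsGaloisGroup I (𝓞 E) (𝓞 L) := .of_isFractionRing _ _ _ E L
  obtain ⟨z, rfl⟩ := Algebra.IsInvariant.isInvariant (A := 𝓞 E) (G := I) x fun σ => hx σ.1 σ.2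
  let q : Ideal (𝓞 E) := Q.under (𝓞 E)
  have hq : q ≠ ⊥ := fun h => hQ (Ideal.eq_bot_of_comap_eq_bot (R := 𝓞 E) h)
  have hmap : q.map (algebraMap (𝓞 E) (𝓞 L)) ≠ ⊥ := by
    rwa [Ne, Ideal.map_eq_bot_iff_of_injective (FaithfulSMul.algebraMap_injective _ _)]
  have : q.IsMaximal := Ideal.IsMaximal.under (𝓞 E) Q
  have : Finite (𝓞 E ⧸ q) := Ring.HasFiniteQuotients.finiteQuotient hq
  have hcard : Nat.card I = Q.ramificationIdx (𝓞 E) := by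
    rw [← Ideal.ramificationIdxIn_eq_ramificationIdx q Q I,
      ← Ideal.card_inertia_eq_ramificationIdxIn (G := I) q Q,
      (eq_top_iff.mpr fun σ _ y => σ.2 y : Q.inertia I = ⊤), Subgroup.card_top]
  rw [hcard, Ideal.IsDedekindDomain.ramificationIdx_eq_multiplicity q Q hmap]
  exact Ideal.dvd_iff_le.mp (pow_multiplicity_dvd Q _) (Ideal.mem_map_of_mem _ hxQ)

theorem hasUnramifiedPrime_of_not_dvd_discr (hp : p.Prime)
    (hpK : ¬ (p : ℤ) ∣ NumberField.discr K) : HasUnramifiedPrime Gal(L/K) (𝓞 L) p := by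
  have hpZ : Prime (p : ℤ) := Nat.prime_iff_prime_int.mp hp
  have := PrincipalIdealRing.isMaximal_of_irreducible hpZ.irreducible
  obtain ⟨Q, _, hover⟩ := Ideal.exists_maximal_ideal_liesOver_of_isIntegral (S := 𝓞 L)
    (Ideal.span {(p : ℤ)})
  have hpQ : (p : 𝓞 L) ∈ Q := by
    simpa using (Ideal.liesOver_span_iff (Ideal.IsPrime.ne_top inferInstance) hpZ).mp hover
  have hQ : Q ≠ ⊥ := by
    rintro rfl
    exact hp.ne_zero (by simpa using hpQ)
  refine ⟨Q, _, inferInstance, hQ, hpQ, fun _ => mem_pow_card_inertia_of_fixed Q K hQ, ?_⟩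
  rw [card_inertia_eq_ramificationIdx Q K hQ, ← ramificationIdx_eq_of_not_dvd_discr Q K hp hpK hpQ]
  exact natCast_notMem_pow_ramificationIdx_succ Q hp hpQ

end Ramification

section GaloisGroup

theorem splits_map_ringOfIntegers {L : Type*} [Field L] [NumberField L] {P : ℤ[X]} (hP : P.Monic)
    (h : (P.map (algebraMap ℤ L)).Splits) : (P.map (algebraMap ℤ (𝓞 L))).Splits := by
  have hmap := map_map_algebraMap_int (algebraMap (𝓞 L) L) P
  refine Splits.of_splits_map_of_injective NumberField.RingOfIntegers.coe_injective
    (hmap ▸ h) fun x hx => ⟨⟨x, P, hP, ?_⟩, rfl⟩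
  rw [hmap] at hx
  exact (eval_map _ _).symm.trans (isRoot_of_mem_roots hx)

theorem splits_map_of_splits_comp {K L : Type*} [Field K] [Field L] [Algebra K L] {p q : K[X]}
    (hq : q.natDegree ≠ 0) (h : ((p.comp q).map (algebraMap K L)).Splits) :
    (p.map (algebraMap K L)).Splits := by
  have := (Gal.splits_in_splittingField_of_comp p q hq).map
    (SplittingField.lift (p.comp q) h : (p.comp q).SplittingField →+* L)
  rwa [Polynomial.map_map, AlgHom.comp_algebraMap] at this

theorem map_iterate_comp {R S : Type*} [CommRing R] [CommRing S] (φ : R →+* S) (f : R[X])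
    (k : ℕ) : (f.comp^[k] X).map φ = (f.map φ).comp^[k] X := by
  induction k with
  | zero => exact map_X φ
  | succ k ih =>
    rw [Function.iterate_succ_apply', Polynomial.map_comp, ih, Function.iterate_succ_apply']

variable {K : Type*} [Field K] {ι : Type*} [Fintype ι] {f : ℤ[X]} {d n : ℕ} {b : ι → ℤ}

namespace HasCriticalPoints

theorem derivative_comp_iterate_comp (hf : HasCriticalPoints f d b) (n : ℕ) :
    (derivative f).comp (f.comp^[n] X) = C (d : ℤ) * ∏ i, (f.comp^[n] X - C (b i)) := by
  simp [hf.derivative_eq, prod_comp]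

theorem derivative_comp_polyIterate (hf : HasCriticalPoints f d b) (n : ℕ) :
    (derivative (f.map (algebraMap ℤ K))).comp (polyIterate (f.map (algebraMap ℤ K)) n) =
      (C (d : ℤ) * ∏ i, (f.comp^[n] X - C (b i))).map (algebraMap ℤ K) := by
  rw [polyIterate, ← map_iterate_comp, derivative_map, ← Polynomial.map_comp,
    hf.derivative_comp_iterate_comp]

theorem splits_iterate_comp_sub_C [CharZero K] (hf : HasCriticalPoints f d b)
    (h : ((C (d : ℤ) * ∏ i, (f.comp^[n] X - C (b i))).map (algebraMap ℤ K)).Splits) {k : ℕ}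
    (hk : k ≤ n) (j : ι) : ((f.comp^[k] X - C (b j)).map (algebraMap ℤ K)).Splits := by
  have hmonic (k : ℕ) (i : ι) : (f.comp^[k] X - C (b i)).Monic :=
    monic_iterate_comp_sub_C hf.monic hf.natDegree_ne_zero k (b i)
  have hne : (C (d : ℤ) * ∏ i, (f.comp^[n] X - C (b i))).map (algebraMap ℤ K) ≠ 0 := by
    rw [Polynomial.map_ne_zero_iff (RingHom.injective_int _)]
    exact mul_ne_zero (by simpa using (zero_lt_one.trans hf.one_lt).ne')
      (monic_prod_of_monic _ _ fun i _ => hmonic n i).ne_zero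
  have hn := h.of_dvd hne (Polynomial.map_dvd _
    ((Finset.dvd_prod_of_mem (fun i => f.comp^[n] X - C (b i)) (Finset.mem_univ j)).mul_left _))
  obtain ⟨m, rfl⟩ := Nat.exists_eq_add_of_le hk
  rw [iterate_comp_add, ← C_comp (p := f.comp^[m] X), ← sub_comp, Polynomial.map_comp] at hn
  rw [← Polynomial.map_id (p := (f.comp^[k] X - C (b j)).map (algebraMap ℤ K))]
  refine splits_map_of_splits_comp (q := (f.comp^[m] X).map (algebraMap ℤ K)) ?_
    (hn.map (algebraMap K K))
  rw [(monic_iterate_comp hf.monic hf.natDegree_ne_zero m).natDegree_map,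
    natDegree_iterate_comp_X]
  exact pow_ne_zero m hf.natDegree_ne_zero

theorem exists_iterate_eq_of_aeval_eq_zero [NumberField K] (hf : HasCriticalPoints f d b) {x : K}
    (hx : aeval x (C (d : ℤ) * ∏ i, (f.comp^[n] X - C (b i))) = 0) :
    ∃ (y : 𝓞 K) (j : ι), (y : K) = x ∧ (aeval · f)^[n] y = b j := by
  have hd : (d : K) ≠ 0 := by exact_mod_cast (zero_lt_one.trans hf.one_lt).ne'
  obtain ⟨j, hj⟩ : ∃ j, aeval x (f.comp^[n] X - C (b j)) = 0 := by
    simpa [hd, Finset.prod_eq_zero_iff] using hx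
  have hint : IsIntegral ℤ x :=
    ⟨_, monic_iterate_comp_sub_C hf.monic hf.natDegree_ne_zero n (b j), hj⟩
  obtain ⟨y, rfl⟩ : ∃ y : 𝓞 K, (y : K) = x := ⟨⟨x, hint⟩, rfl⟩
  refine ⟨y, j, rfl, NumberField.RingOfIntegers.coe_injective ?_⟩
  rw [map_iterate_aeval_int (algebraMap (𝓞 K) K)]
  rw [aeval_iterate_comp_sub_C, sub_eq_zero] at hj
  exact hj.trans (by simp)

theorem faithfulSMul_intBackwardLevel {P : K[X]} [NumberField P.SplittingField]
    (hf : HasCriticalPoints f d b)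
    (hP : P = (C (d : ℤ) * ∏ i, (f.comp^[n] X - C (b i))).map (algebraMap ℤ K)) :
    FaithfulSMul Gal(P.SplittingField/K)
      (intBackwardLevel Gal(P.SplittingField/K) (𝓞 P.SplittingField) f b n) where
  eq_of_smul_eq_smul {σ τ} h := by
    refine Gal.ext _ fun x hx => ?_
    replace hx := (congrArg (aeval x) hP).symm.trans (mem_rootSet.mp hx).2
    rw [aeval_map_algebraMap] at hx
    obtain ⟨y, j, rfl, hy⟩ := hf.exists_iterate_eq_of_aeval_eq_zero hx
    exact congrArg (fun z => algebraMap (𝓞 P.SplittingField) P.SplittingField z.1) (h ⟨y, j, hy⟩)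

theorem nonempty_gal_mulEquiv (K : Type*) [Field K] [NumberField K]
    (hf : HasCriticalPoints f d b) (hb : Function.Injective b)
    (hE : ∀ j, ∃ p : ℕ, ¬ (p : ℤ) ∣ NumberField.discr K ∧ EisensteinPrime f 1 d (b j) p)
    (hC : 3 ≤ d → ∀ j, ∃ (p : ℕ) (c : ℤ), ¬ (p : ℤ) ∣ NumberField.discr K ∧
      EisensteinPrime f (X - C c) (d - 1) (b j) p)
    (hT : ∀ k < n, ∀ j, ∃ p : ℕ, ¬ (p : ℤ) ∣ NumberField.discr K ∧
      TranspositionPrime f b d k j p) :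
    Nonempty (((derivative (f.map (algebraMap ℤ K))).comp
      (polyIterate (f.map (algebraMap ℤ K)) n)).Gal ≃* (ι → iteratedSymWreath d n)) := by
  set P := (derivative (f.map (algebraMap ℤ K))).comp (polyIterate (f.map (algebraMap ℤ K)) n)
  have hP : P = (C (d : ℤ) * ∏ i, (f.comp^[n] X - C (b i))).map (algebraMap ℤ K) :=
    hf.derivative_comp_polyIterate n
  let L := P.SplittingField
  have : NumberField L := NumberField.of_module_finite K L
  have : Normal K L := Normal.of_isSplittingField P
  have : IsGalois K L := { }
  have := hf.faithfulSMul_intBackwardLevel hP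
  have hL : ((C (d : ℤ) * ∏ i, (f.comp^[n] X - C (b i))).map (algebraMap ℤ L)).Splits := by
    rw [← RingHom.ext_int ((algebraMap K L).comp (algebraMap ℤ K)) (algebraMap ℤ L),
      ← Polynomial.map_map, ← hP]
    exact SplittingField.splits P
  refine nonempty_mulEquiv_of_local_conditions (G := Gal(L/K)) (B := 𝓞 L) hf
    (fun i j h => hb (by simpa using h)) (fun k hk j => splits_map_ringOfIntegers
      (monic_iterate_comp_sub_C hf.monic hf.natDegree_ne_zero k (b j))
      (hf.splits_iterate_comp_sub_C hL hk j))
    (fun j => ?_) (fun hd j => ?_) (fun k hk j => ?_)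
  · obtain ⟨p, hp, h⟩ := hE j
    exact ⟨p, hasUnramifiedPrime_of_not_dvd_discr K h.prime hp, h⟩
  · obtain ⟨p, c, hp, h⟩ := hC hd j
    exact ⟨p, c, hasUnramifiedPrime_of_not_dvd_discr K h.prime hp, h⟩
  · obtain ⟨p, hp, h⟩ := hT k hk j
    exact ⟨p, hasUnramifiedPrime_of_not_dvd_discr K h.prime hp, h⟩

end HasCriticalPoints

end GaloisGroup

end NumberField

section PrimeDivisors

open Polynomial

theorem isUnit_of_algebraMap_mul_eq_one {R A : Type*} [CommRing R] [CommRing A] [Algebra R A]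
    [FaithfulSMul R A] {r : R} {s : A} (hs : IsIntegral R s) (h : algebraMap R A r * s = 1) :
    IsUnit r := by
  have hinj : Function.Injective (algebraMap R (integralClosure R A)) := fun x y hxy =>
    FaithfulSMul.algebraMap_injective R A (congrArg Subtype.val hxy)
  have : IsLocalHom (algebraMap R (integralClosure R A)) :=
    (algebraMap_isIntegral_iff.mpr inferInstance).isLocalHom hinj
  exact isUnit_of_map_unit (algebraMap R (integralClosure R A)) r
    (IsUnit.of_mul_eq_one (⟨s, hs⟩ : integralClosure R A) (Subtype.ext h))

theorem exists_mem_eval_notMem {R : Type*} [CommRing R] [IsDomain R] {r : R[X]}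
    (hr : 0 < r.natDegree) {s t : Set R} (hs : s.Infinite) (ht : t.Finite) :
    ∃ x ∈ s, r.eval x ∉ t := by
  have hne (a : R) : r - C a ≠ 0 := fun h => by simp [sub_eq_zero.mp h] at hr
  have hfin : ((r.eval ·) ⁻¹' t).Finite := ht.preimage' fun a _ =>
    (finite_setOfPred_isRoot (hne a)).subset fun x hx => by
      simpa [sub_eq_zero] using hx
  obtain ⟨x, hx, hxt⟩ := (hs.sdiff hfin).nonempty
  exact ⟨x, hx, hxt⟩

theorem exists_prime_dvd_one_add_factorial_mul {N : ℕ} {s : ℤ}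
    (h : (1 + N.factorial * s).natAbs ≠ 1) :
    ∃ p : ℕ, p.Prime ∧ N < p ∧ (p : ℤ) ∣ 1 + N.factorial * s := by
  obtain ⟨p, hp, hdvd⟩ := Nat.exists_prime_and_dvd h
  rw [← Int.natCast_dvd] at hdvd
  refine ⟨p, hp, not_le.mp fun hle => ?_, hdvd⟩
  have hfac : (p : ℤ) ∣ N.factorial := by exact_mod_cast hp.dvd_factorial.mpr hle
  have hone := (Int.dvd_add_left (hfac.mul_right s)).mp hdvd
  exact hp.one_lt.ne' (by exact_mod_cast Int.eq_one_of_dvd_one p.cast_nonneg hone)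

/-- Schur's argument: a value `a = r(x₀) ≠ 0` divides `r(x₀ + a N! t)`, with a quotient
congruent to `1` modulo `N!`. -/
theorem exists_prime_dvd_eval {r : ℤ[X]} (hr : 0 < r.natDegree) (N : ℕ) :
    ∃ (p : ℕ) (x : ℤ), p.Prime ∧ N < p ∧ (p : ℤ) ∣ r.eval x := by
  obtain ⟨x₀, -, hx₀⟩ := exists_mem_eval_notMem hr Set.infinite_univ (Set.finite_singleton 0)
  set a := r.eval x₀
  have hN : (N.factorial : ℤ) ≠ 0 := by exact_mod_cast N.factorial_ne_zero
  have hinf : (Set.range fun t : ℤ => x₀ + a * N.factorial * t).Infinite :=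
    Set.infinite_range_of_injective fun t t' h =>
      mul_left_cancel₀ (mul_ne_zero hx₀ hN) (add_left_cancel h)
  obtain ⟨_, ⟨t, rfl⟩, ht⟩ := exists_mem_eval_notMem hr hinf (Set.toFinite {a, -a})
  set x := x₀ + a * N.factorial * t
  obtain ⟨s, hs⟩ : a * N.factorial * t ∣ r.eval x - a := by
    simpa [x] using sub_dvd_eval_sub x x₀ r
  have hfac : r.eval x = a * (1 + N.factorial * (t * s)) := by linear_combination hs
  have hunit : (1 + N.factorial * (t * s) : ℤ).natAbs ≠ 1 := by
    rw [Ne, Int.natAbs_eq_iff]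
    rintro (h | h) <;> exact ht (by rw [show r.eval _ = _ from hfac, h]; simp)
  obtain ⟨p, hp, hNp, hdvd⟩ := exists_prime_dvd_one_add_factorial_mul hunit
  exact ⟨p, x, hp, hNp, hfac ▸ hdvd.mul_left a⟩

theorem exists_ne_zero_forall_dvd_eval {z : ℂ} (hz : IsIntegral ℤ z) {S : ℤ[X]}
    (hS : aeval z S ≠ 0) :
    ∃ a : ℤ, a ≠ 0 ∧ ∀ p x : ℤ, p ∣ (minpoly ℤ z).eval x → p ∣ S.eval x → p ∣ a := by
  have hw : IsIntegral ℤ (aeval z S) :=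
    adjoin_le_integralClosure hz (aeval_mem_adjoin_singleton ℤ z)
  set q := minpoly ℤ (aeval z S)
  refine ⟨q.coeff 0, fun h => hS ((minpoly.coeff_zero_eq_zero (A := ℚ) hw.tower_top).mp ?_),
    fun p x hp hpS => ?_⟩
  · rw [minpoly.isIntegrallyClosed_eq_field_fractions' ℚ hw, coeff_map, h, map_zero]
  · have hdvd : minpoly ℤ z ∣ q.comp S := minpoly.isIntegrallyClosed_dvd hz (by
      rw [aeval_comp, minpoly.aeval])
    have hq : p ∣ q.eval (S.eval x) := eval_comp (p := q) ▸ hp.trans (eval_dvd hdvd)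
    have hsub : S.eval x ∣ q.eval (S.eval x) - q.coeff 0 := by
      simpa [coeff_zero_eq_eval_zero] using sub_dvd_eval_sub (S.eval x) 0 q
    exact (Int.dvd_iff_dvd_of_dvd_sub (hpS.trans hsub)).mp hq

theorem exists_prime_dvd_eval_not_dvd_eval {z : ℂ} (hz : IsIntegral ℤ z) {R S : ℤ[X]}
    (hR : aeval z R = 0) (hS : aeval z S ≠ 0) (N : ℕ) :
    ∃ (p : ℕ) (x : ℤ), p.Prime ∧ N < p ∧ (p : ℤ) ∣ R.eval x ∧ ¬ (p : ℤ) ∣ S.eval x := by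
  obtain ⟨a, ha, hdvd⟩ := exists_ne_zero_forall_dvd_eval hz hS
  obtain ⟨p, x, hp, hN, hpx⟩ := exists_prime_dvd_eval (minpoly.natDegree_pos hz) (max N a.natAbs)
  rw [max_lt_iff] at hN
  exact ⟨p, x, hp, hN.1, hpx.trans (eval_dvd (minpoly.isIntegrallyClosed_dvd hz hR)), fun h =>
    Nat.not_dvd_of_pos_of_lt (Int.natAbs_pos.mpr ha) hN.2 (Int.natCast_dvd.mp (hdvd p x hpx h))⟩

/-- If `p ^ 2` divides `R(x)`, replace `x` by `x + p`. -/
theorem exists_not_dvd_eval_eq_mul {R S : ℤ[X]} {p : ℕ} {x : ℤ}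
    (hR : (p : ℤ) ∣ R.eval x) (hR' : ¬ (p : ℤ) ∣ (derivative R).eval x)
    (hS : ¬ (p : ℤ) ∣ S.eval x) :
    ∃ y u : ℤ, ¬ (p : ℤ) ∣ u ∧ R.eval y = p * u ∧ ¬ (p : ℤ) ∣ S.eval y := by
  obtain ⟨v, hv⟩ := hR
  by_cases h : (p : ℤ) ∣ v
  · obtain ⟨k, hk⟩ := R.binomExpansion x p
    have hS' : (p : ℤ) ∣ S.eval (x + p) - S.eval x := by
      simpa using sub_dvd_eval_sub (x + p) x S
    refine ⟨x + p, v + (derivative R).eval x + k * p, ?_, by rw [hk, hv]; ring,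
      fun hp => hS ((Int.dvd_iff_dvd_of_dvd_sub hS').mp hp)⟩
    rwa [add_assoc, Int.dvd_add_right h, Int.dvd_add_left (dvd_mul_left _ _)]
  · exact ⟨x, v, h, hv, hS⟩

theorem exists_prime_eval_eq_mul_of_isIntegral {z : ℂ} (hz : IsIntegral ℤ z) {R : ℤ[X]}
    (hR : aeval z R = 0) (hR' : aeval z (derivative R) ≠ 0) {α : Type*} (s : Finset α)
    (S : α → ℤ[X]) (N : ℕ) :
    ∃ (p : ℕ) (c u : ℤ), p.Prime ∧ N < p ∧ ¬ (p : ℤ) ∣ u ∧ R.eval c = p * u ∧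
      ∀ t ∈ s, (p : ℤ) ∣ (S t).eval c → aeval z (S t) = 0 := by
  classical
  set T : ℤ[X] := ∏ t ∈ s with aeval z (S t) ≠ 0, S t
  have hT : aeval z T ≠ 0 := by
    rw [map_prod]
    exact Finset.prod_ne_zero_iff.mpr fun t ht => (Finset.mem_filter.mp ht).2
  obtain ⟨p, x, hp, hN, hpR, hpT⟩ := exists_prime_dvd_eval_not_dvd_eval hz hR
    (S := derivative R * T) (by simpa only [map_mul] using mul_ne_zero hR' hT) N
  rw [eval_mul] at hpT
  obtain ⟨c, u, hu, hc, hcT⟩ := exists_not_dvd_eval_eq_mul hpR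
    (fun h => hpT (h.mul_right _)) (fun h => hpT (h.mul_left _))
  refine ⟨p, c, u, hp, hN, hu, hc, fun t ht hdvd => ?_⟩
  by_contra h
  exact hcT (hdvd.trans (eval_dvd (Finset.dvd_prod_of_mem S (Finset.mem_filter.mpr ⟨ht, h⟩))))

end PrimeDivisors

section Bicritical

open Polynomial

/-- The polynomial map `y ↦ y ^ d - d B y ^ (d - 1) + c`, which has at most two critical points,
`(d - 1) B` and `0`. It serves as the model of a polynomial with prescribed reduction modulo the
square of a prime; as a polynomial it is `bicritical d B (C c) X`. -/
def bicritical {R : Type*} [CommRing R] (d B : ℕ) (c y : R) : R :=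
  y ^ d - d * B * y ^ (d - 1) + c

theorem map_bicritical_iterate {R S : Type*} [CommRing R] [CommRing S] (φ : R →+* S) (d B : ℕ)
    (c y : R) (k : ℕ) :
    φ ((bicritical d B c)^[k] y) = (bicritical d B (φ c))^[k] (φ y) := by
  have h : Function.Semiconj φ (bicritical d B c) (bicritical d B (φ c)) := fun y => by
    simp [bicritical]
  exact h.iterate_right k y

theorem eval_bicritical {R : Type*} [CommRing R] (d B : ℕ) (c x : R) :
    (bicritical d B (C c) X).eval x = bicritical d B c x := by
  simp [bicritical]

theorem bicritical_zero {R : Type*} [CommRing R] {d : ℕ} (hd : 2 ≤ d) (B : ℕ) (c : R) :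
    bicritical d B c 0 = c := by
  simp [bicritical, show d ≠ 0 by omega, show d - 1 ≠ 0 by omega]

theorem bicritical_critical {R : Type*} [CommRing R] {d : ℕ} (hd : 2 ≤ d) (B : ℕ) (c : R) :
    bicritical d B c ((d - 1) * B) = c - (d - 1) ^ (d - 1) * B ^ d := by
  obtain ⟨e, rfl⟩ : ∃ e, d = e + 1 := ⟨d - 1, by omega⟩
  rw [bicritical, Nat.add_sub_cancel]
  push_cast
  ring

theorem bicritical_eq_mul_add {R : Type*} [CommRing R] {d : ℕ} (hd : d ≠ 0) (B : ℕ) (c y : R) :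
    bicritical d B c y = y ^ (d - 1) * (y - d * B) + c := by
  rw [bicritical, mul_sub, pow_sub_one_mul hd, mul_comm (y ^ (d - 1))]

theorem monic_bicritical {R : Type*} [CommRing R] [Nontrivial R] {d : ℕ} (hd : 2 ≤ d) (B : ℕ)
    {q : R[X]} (hq : q.Monic) (hq1 : 1 ≤ q.natDegree) :
    (bicritical d B X q).Monic ∧ (bicritical d B X q).natDegree = d * q.natDegree := by
  have hle : (C (d * B : R)).natDegree < q.natDegree := by rwa [natDegree_C]
  have hsub : (q - C (d * B : R)).Monic := hq.sub_of_left (degree_lt_degree hle)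
  have hdeg : (q ^ (d - 1) * (q - C (d * B : R))).natDegree = d * q.natDegree := by
    rw [(hq.pow _).natDegree_mul hsub, hq.natDegree_pow, natDegree_sub_C, ← Nat.succ_mul,
      Nat.succ_eq_add_one, Nat.sub_add_cancel (by omega)]
  have hlt : (X : R[X]).natDegree < (q ^ (d - 1) * (q - C (d * B : R))).natDegree := by
    rw [natDegree_X, hdeg]
    nlinarith
  have heq : bicritical d B X q = q ^ (d - 1) * (q - C (d * B : R)) + X := by
    rw [bicritical_eq_mul_add (by omega), C_mul, map_natCast, map_natCast]
  rw [heq, natDegree_add_eq_left_of_natDegree_lt hlt]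
  exact ⟨((hq.pow _).mul hsub).add_of_left (degree_lt_degree hlt), hdeg⟩

/-- The `k`-th point of the orbit of `a` under `y ↦ y ^ d - d B y ^ (d - 1) + c`, as a polynomial
in the parameter `c`. -/
noncomputable def paramOrbit (d B : ℕ) (a : ℤ) (k : ℕ) : ℤ[X] :=
  (bicritical d B X)^[k] (a : ℤ[X])

theorem aeval_paramOrbit {R : Type*} [CommRing R] (d B : ℕ) (a : ℤ) (k : ℕ) (c : R) :
    aeval c (paramOrbit d B a k) = (bicritical d B c)^[k] (a : R) := by
  simpa [paramOrbit] using map_bicritical_iterate (aeval c : ℤ[X] →ₐ[ℤ] R).toRingHom d B X a k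

theorem eval_paramOrbit (d B : ℕ) (a : ℤ) (k : ℕ) (c : ℤ) :
    (paramOrbit d B a k).eval c = (bicritical d B c)^[k] a := by
  rw [← coe_aeval_eq_eval, aeval_paramOrbit, Int.cast_id]

theorem monic_paramOrbit_succ {d : ℕ} (hd : 2 ≤ d) (B : ℕ) (a : ℤ) (k : ℕ) :
    (paramOrbit d B a (k + 1)).Monic ∧ (paramOrbit d B a (k + 1)).natDegree = d ^ k := by
  induction k with
  | zero =>
    have h : paramOrbit d B a 1 = X + C (a ^ d - d * B * a ^ (d - 1)) := by
      simp [paramOrbit, bicritical, add_comm]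
    rw [zero_add, h, natDegree_X_add_C, pow_zero]
    exact ⟨monic_X_add_C _, rfl⟩
  | succ k ih =>
    rw [paramOrbit, Function.iterate_succ_apply', pow_succ', ← ih.2]
    exact monic_bicritical hd B ih.1 (ih.2 ▸ Nat.one_le_pow _ _ (by omega))

theorem monic_paramOrbit_succ_sub {d : ℕ} (hd : 2 ≤ d) (B : ℕ) (a b : ℤ) (k : ℕ) :
    (paramOrbit d B a (k + 1) - (b : ℤ[X])).Monic ∧
      (paramOrbit d B a (k + 1) - (b : ℤ[X])).natDegree = d ^ k := by
  obtain ⟨hmonic, hdeg⟩ := monic_paramOrbit_succ hd B a k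
  have hlt : (b : ℤ[X]).natDegree < (paramOrbit d B a (k + 1)).natDegree := by
    rw [natDegree_intCast, hdeg]
    exact Nat.pow_pos (by omega)
  exact ⟨hmonic.sub_of_left (degree_lt_degree hlt),
    by rw [natDegree_sub_eq_left_of_natDegree_lt hlt, hdeg]⟩

theorem exists_derivative_paramOrbit_succ (d B : ℕ) (a : ℤ) (k : ℕ) :
    ∃ S : ℤ[X], derivative (paramOrbit d B a (k + 1)) = 1 + d * S := by
  rw [paramOrbit, Function.iterate_succ_apply']
  set q := (bicritical d B X)^[k] (a : ℤ[X])
  refine ⟨q ^ (d - 1) * derivative q - B * derivative (q ^ (d - 1)), ?_⟩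
  simp only [bicritical, derivative_sub, derivative_add, derivative_natCast, derivative_X,
    derivative_mul, derivative_pow, map_natCast]
  ring

theorem aeval_derivative_paramOrbit_succ_ne_zero {d : ℕ} (hd : 2 ≤ d) (B : ℕ) (a : ℤ) (k : ℕ)
    {z : ℂ} (hz : IsIntegral ℤ z) :
    aeval z (derivative (paramOrbit d B a (k + 1))) ≠ 0 := by
  obtain ⟨S, hS⟩ := exists_derivative_paramOrbit_succ d B a k
  have hint : IsIntegral ℤ (aeval z S) :=
    adjoin_le_integralClosure hz (aeval_mem_adjoin_singleton ℤ z)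
  intro h
  rw [hS, map_add, map_mul, map_one, map_natCast] at h
  have hunit : IsUnit (d : ℤ) := isUnit_of_algebraMap_mul_eq_one hint.neg (by
    rw [map_natCast]
    linear_combination -h)
  rw [Int.ofNat_isUnit, Nat.isUnit_iff] at hunit
  omega

theorem exists_root_not_root {K : Type*} [Field K] [IsAlgClosed K] {P Q : K[X]}
    (hP : P.Separable) (hQ : Q ≠ 0) (hdeg : Q.natDegree < P.natDegree) :
    ∃ x, P.eval x = 0 ∧ Q.eval x ≠ 0 := by
  by_contra! h
  have hle : P.roots ≤ Q.roots := (Multiset.le_iff_subset (nodup_roots hP)).mpr fun x hx =>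
    (mem_roots hQ).mpr (h x (isRoot_of_mem_roots hx))
  have hcard := (Multiset.card_le_card hle).trans Q.card_roots'
  rw [IsAlgClosed.card_roots_eq_natDegree] at hcard
  exact hcard.not_gt hdeg

theorem separable_map_paramOrbit_succ_sub {d : ℕ} (hd : 2 ≤ d) (B : ℕ) (a b : ℤ) (k : ℕ) :
    ((paramOrbit d B a (k + 1) - (b : ℤ[X])).map (algebraMap ℤ ℂ)).Separable := by
  rw [Separable, isCoprime_iff_aeval_ne_zero_of_isAlgClosed ℂ ℂ]
  intro z
  rw [derivative_map, aeval_map_algebraMap, aeval_map_algebraMap, ← not_and_or, derivative_sub,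
    derivative_intCast, sub_zero]
  rintro ⟨h, h'⟩
  exact aeval_derivative_paramOrbit_succ_ne_zero hd B a k
    ⟨_, (monic_paramOrbit_succ_sub hd B a b k).1, h⟩ h'

/-- The parameters with `F^[k] a = a` for some `k ≤ m` number at most `1 + d + ⋯ + d ^ (m - 1)`,
fewer than the `d ^ m` parameters with `F^[m + 1] a = a`. -/
theorem exists_minimalPeriod_bicritical {d : ℕ} (hd : 2 ≤ d) (B : ℕ) (a : ℤ) (m : ℕ) :
    ∃ c : ℂ, IsIntegral ℤ c ∧ Function.minimalPeriod (bicritical d B c) (a : ℂ) = m + 1 := by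
  set R : ℕ → ℤ[X] := fun k => paramOrbit d B a (k + 1) - (a : ℤ[X])
  have hmonic (k) : (R k).Monic := (monic_paramOrbit_succ_sub hd B a a k).1
  have hQ : (∏ k ∈ Finset.range m, R k).Monic := monic_prod_of_monic _ _ fun k _ => hmonic k
  have hdeg : (∏ k ∈ Finset.range m, R k).natDegree < (R m).natDegree := by
    rw [natDegree_prod_of_monic _ _ fun k _ => hmonic k]
    simp only [R, (monic_paramOrbit_succ_sub hd B a a _).2]
    exact Nat.geomSum_lt hd (by simp)
  obtain ⟨c, hc, hck⟩ := exists_root_not_root (separable_map_paramOrbit_succ_sub hd B a a m)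
    (hQ.map (algebraMap ℤ ℂ)).ne_zero (by rwa [hQ.natDegree_map, (hmonic m).natDegree_map])
  rw [eval_map_algebraMap] at hc hck
  rw [map_prod, Finset.prod_ne_zero_iff] at hck
  have hR (k) : aeval c (R k) = 0 ↔ Function.IsPeriodicPt (bicritical d B c) (k + 1) (a : ℂ) := by
    rw [map_sub, aeval_paramOrbit, map_intCast, sub_eq_zero]
    rfl
  have hper := (hR m).mp hc
  refine ⟨c, ⟨R m, hmonic m, hc⟩, (hper.minimalPeriod_le m.succ_pos).eq_of_not_lt fun hlt => ?_⟩
  obtain ⟨l, hl⟩ := Nat.exists_eq_add_one_of_ne_zero (hper.minimalPeriod_pos m.succ_pos).ne'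
  exact hck l (Finset.mem_range.mpr (by omega))
    ((hR l).mpr (hl ▸ Function.isPeriodicPt_minimalPeriod _ _))

end Bicritical

section Escape

variable {d B : ℕ} {c : ℂ}

theorem norm_le_norm_bicritical (hd : 2 ≤ d) {x : ℂ} (hx : d * B + 2 ≤ ‖x‖) (hc : ‖c‖ ≤ ‖x‖) :
    ‖x‖ ≤ ‖bicritical d B c x‖ := by
  have hdB : (0 : ℝ) ≤ d * B := by positivity
  have hpow : ‖x‖ ≤ ‖x‖ ^ (d - 1) := le_self_pow₀ (by linarith) (by omega)
  have hsub : 2 ≤ ‖x - d * B‖ := by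
    have h := norm_sub_norm_le x (d * B)
    rw [norm_mul, Complex.norm_natCast, Complex.norm_natCast] at h
    linarith
  have hmul : ‖x‖ * 2 ≤ ‖x ^ (d - 1) * (x - d * B)‖ := by
    rw [norm_mul, norm_pow]
    gcongr
  have hadd := norm_sub_le (x ^ (d - 1) * (x - d * B) + c) c
  rw [add_sub_cancel_right] at hadd
  rw [bicritical_eq_mul_add (by omega)]
  linarith

theorem norm_le_norm_bicritical_iterate (hd : 2 ≤ d) {x : ℂ} (hx : d * B + 2 ≤ ‖x‖)
    (hc : ‖c‖ ≤ ‖x‖) (k : ℕ) : ‖x‖ ≤ ‖(bicritical d B c)^[k] x‖ := by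
  induction k with
  | zero => exact le_rfl
  | succ k ih =>
    rw [Function.iterate_succ_apply']
    exact ih.trans (norm_le_norm_bicritical hd (hx.trans ih) (hc.trans ih))

theorem norm_le_norm_bicritical_iterate_zero (hd : 2 ≤ d) (hc : d * B + 2 ≤ ‖c‖) {k : ℕ}
    (hk : k ≠ 0) : ‖c‖ ≤ ‖(bicritical d B c)^[k] 0‖ := by
  obtain ⟨l, rfl⟩ := Nat.exists_eq_add_one_of_ne_zero hk
  rw [Function.iterate_succ_apply, bicritical_zero hd]
  exact norm_le_norm_bicritical_iterate hd hc le_rfl l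

theorem two_mul_add_two_le (hd : 2 ≤ d) (hB : 3 * d ≤ B) :
    2 * (d * B + 2) ≤ (d - 1) ^ (d - 1) * B ^ d :=
  calc 2 * (d * B + 2) ≤ 3 * d * B := by nlinarith
    _ ≤ B ^ 2 := by rw [sq]; gcongr
    _ ≤ B ^ d := Nat.pow_le_pow_right (by omega) hd
    _ ≤ (d - 1) ^ (d - 1) * B ^ d := Nat.le_mul_of_pos_left _ (Nat.pow_pos (by omega))

theorem norm_sub_one_mul_le (hd : 1 ≤ d) (B : ℕ) : ‖((d - 1) * B : ℂ)‖ ≤ d * B := by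
  rw [← Nat.cast_pred hd, norm_mul, Complex.norm_natCast, Complex.norm_natCast]
  gcongr
  exact d.sub_le 1

theorem lt_norm_of_isPeriodicPt (hd : 2 ≤ d) (hB : 3 * d ≤ B) {m : ℕ}
    (hper : Function.IsPeriodicPt (bicritical d B c) (m + 1) ((d - 1) * B)) :
    d * B + 2 < ‖c‖ := by
  by_contra! hc
  set V : ℕ := (d - 1) ^ (d - 1) * B ^ d
  have hV : 2 * (d * B + 2 : ℝ) ≤ V := by exact_mod_cast two_mul_add_two_le hd hB
  have hone : (1 : ℕ) ≤ d := by omega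
  have hval : bicritical d B c ((d - 1) * B) = c - V := by
    rw [bicritical_critical hd]
    push_cast [V, Nat.cast_sub hone]
    rfl
  have hlow : d * B + 2 ≤ ‖c - V‖ := by
    have h := norm_sub_norm_le (V : ℂ) c
    rw [Complex.norm_natCast, norm_sub_rev] at h
    linarith
  have hle := norm_le_norm_bicritical_iterate hd hlow (hc.trans hlow) m
  rw [← hval, ← Function.iterate_succ_apply, hper.eq, hval] at hle
  linarith [norm_sub_one_mul_le hone B]

/-- When the critical point `(d - 1) B` is periodic, the critical point `0` escapes to infinity, so
that there are no coincidences between the two critical orbits. -/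
theorem eq_of_bicritical_iterate_eq (hd : 2 ≤ d) (hB : 3 * d ≤ B) {m : ℕ}
    (hper : Function.minimalPeriod (bicritical d B c) ((d - 1) * B) = m + 1) {x y : ℂ}
    (hx : x = (d - 1) * B ∨ x = 0) (hy : y = (d - 1) * B ∨ y = 0) {k : ℕ} (hk : 1 ≤ k)
    (hkm : k ≤ m + 1) (h : (bicritical d B c)^[k] x = y) :
    x = (d - 1) * B ∧ y = (d - 1) * B ∧ k = m + 1 := by
  have hperiodic := hper ▸ Function.isPeriodicPt_minimalPeriod (bicritical d B c) ((d - 1) * B)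
  have hc := lt_norm_of_isPeriodicPt hd hB hperiodic
  have hzero (l) (hl : l ≠ 0) (z : ℂ) (hz : z = (d - 1) * B ∨ z = 0) :
      (bicritical d B c)^[l] 0 ≠ z := by
    rintro rfl
    have hle := hc.le.trans (norm_le_norm_bicritical_iterate_zero hd hc.le hl)
    rcases hz with hz | hz <;> rw [hz] at hle
    · linarith [norm_sub_one_mul_le (by omega : 1 ≤ d) B]
    · rw [norm_zero] at hle
      linarith [(by positivity : (0 : ℝ) ≤ d * B)]
  rcases hx with rfl | rfl
  · rcases hy with rfl | rfl
    · have hdvd : m + 1 ∣ k := hper ▸ Function.IsPeriodicPt.minimalPeriod_dvd h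
      exact ⟨rfl, rfl, hkm.antisymm (Nat.le_of_dvd hk hdvd)⟩
    · exact absurd (h ▸ hperiodic.apply_iterate k) (hzero _ m.succ_ne_zero 0 (.inr rfl))
  · exact absurd h (hzero k (by omega) y hy)

end Escape

section TranspositionModel

open Polynomial

theorem exists_prime_bicritical {d B : ℕ} (hd : 2 ≤ d) (hB : 3 * d ≤ B) {a : ℤ}
    (ha : a = (d - 1) * B) (m N : ℕ) :
    ∃ (p : ℕ) (c u : ℤ), p.Prime ∧ N < p ∧ ¬ (p : ℤ) ∣ u ∧
      (bicritical d B c)^[m + 1] a - a = p * u ∧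
      ∀ k x y, 1 ≤ k → k ≤ m + 1 → (x = a ∨ x = 0) → (y = a ∨ y = 0) →
        (p : ℤ) ∣ (bicritical d B c)^[k] x - y → x = a ∧ y = a ∧ k = m + 1 := by
  have haC : (a : ℂ) = (d - 1) * B := by rw [ha]; push_cast; rfl
  obtain ⟨z, hz, hper⟩ := exists_minimalPeriod_bicritical hd B a m
  have hroot : aeval z (paramOrbit d B a (m + 1) - (a : ℤ[X])) = 0 := by
    rw [map_sub, aeval_paramOrbit, map_intCast, ← hper, Function.iterate_minimalPeriod, sub_self]
  have hsimple : aeval z (derivative (paramOrbit d B a (m + 1) - (a : ℤ[X]))) ≠ 0 := by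
    rw [derivative_sub, derivative_intCast, sub_zero]
    exact aeval_derivative_paramOrbit_succ_ne_zero hd B a m hz
  obtain ⟨p, c, u, hp, hN, hu, hc, hrel⟩ := exists_prime_eval_eq_mul_of_isIntegral hz hroot hsimple
    (Finset.Icc 1 (m + 1) ×ˢ ({a, 0} : Finset ℤ) ×ˢ ({a, 0} : Finset ℤ))
    (fun t => paramOrbit d B t.2.1 t.1 - (t.2.2 : ℤ[X])) N
  refine ⟨p, c, u, hp, hN, hu, by simpa [eval_paramOrbit] using hc,
    fun k x y hk hkm hx hy hdvd => ?_⟩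
  have hxy := hrel (k, x, y) (by simp [hk, hkm, hx, hy]) (by simpa [eval_paramOrbit] using hdvd)
  rw [map_sub, aeval_paramOrbit, map_intCast, sub_eq_zero] at hxy
  have hcast {x : ℤ} (hx : x = a ∨ x = 0) : (x : ℂ) = (d - 1) * B ∨ (x : ℂ) = 0 :=
    hx.imp (fun h => by rw [h, haC]) fun h => by rw [h, Int.cast_zero]
  obtain ⟨hxa, hya, hk⟩ :=
    eq_of_bicritical_iterate_eq hd hB (haC ▸ hper) (hcast hx) (hcast hy) hk hkm hxy
  rw [← haC, Int.cast_inj] at hxa hya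
  exact ⟨hxa, hya, hk⟩

theorem exists_transpositionPrime_bicritical {ι : Type*} [DecidableEq ι] {d B : ℕ} (hd : 2 ≤ d)
    (hB : 3 * d ≤ B) (j : ι) (m N : ℕ) :
    ∃ (p : ℕ) (c : ℤ), N < p ∧
      TranspositionPrime (bicritical d B (C c) X) (Pi.single j ((d - 1) * B)) d m j p := by
  set a : ℤ := (d - 1) * B with ha
  have ha0 : 0 < a := mul_pos (by omega) (by omega)
  obtain ⟨p, c, u, hp, hN, hu, hper, horbit⟩ :=
    exists_prime_bicritical hd hB ha m (max N (max d a.natAbs))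
  simp only [max_lt_iff] at hN
  have hval (i : ι) : (Pi.single j a : ι → ℤ) i = a ∨ (Pi.single j a : ι → ℤ) i = 0 := by
    rw [Pi.single_apply]
    split_ifs <;> simp
  have heq {i : ι} (h : (Pi.single j a : ι → ℤ) i = a) : i = j := by
    by_contra hij
    rw [Pi.single_eq_of_ne hij] at h
    exact ha0.ne h
  refine ⟨p, c, hN.1, hp, Nat.not_dvd_of_pos_of_lt (by omega) hN.2.1,
    ⟨u, hu, by simpa only [eval_bicritical, Pi.single_eq_same] using hper⟩, fun i hij hdvd => ?_,
    fun i j' k hk hkm hdvd => ?_⟩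
  · rw [Pi.single_eq_of_ne hij, Pi.single_eq_same, zero_sub, dvd_neg, Int.natCast_dvd] at hdvd
    exact Nat.not_dvd_of_pos_of_lt (by omega) hN.2.2 hdvd
  · simp only [eval_bicritical] at hdvd
    obtain ⟨hi, hj', hk⟩ := horbit k _ _ hk hkm (hval i) (hval j') hdvd
    exact ⟨heq hi, heq hj', hk⟩

end TranspositionModel

section Antiderivative

open Polynomial

theorem exists_derivative_eq {q : ℤ[X]} (hq : ∀ k : ℕ, (k + 1 : ℤ) ∣ q.coeff k) (c : ℤ) :
    ∃ f : ℤ[X], derivative f = q ∧ f.coeff 0 = c := by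
  choose r hr using hq
  refine ⟨∑ k ∈ q.support, monomial (k + 1) (r k) + C c, ?_, ?_⟩
  · conv_rhs => rw [q.as_sum_support]
    rw [derivative_add, derivative_C, add_zero, derivative_sum]
    refine Finset.sum_congr rfl fun k _ => ?_
    rw [derivative_monomial, Nat.add_sub_cancel, hr, mul_comm, Nat.cast_succ]
  · simp [coeff_monomial]

theorem dvd_prod_sub_prod {R ι : Type*} [CommRing R] {r : R} {F G : ι → R} {s : Finset ι}
    (h : ∀ i ∈ s, r ∣ F i - G i) : r ∣ ∏ i ∈ s, F i - ∏ i ∈ s, G i := by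
  simp only [← Ideal.mem_span_singleton, ← SModEq.sub_mem] at h ⊢
  exact SModEq.prod h

theorem C_dvd_of_C_dvd_derivative {f : ℤ[X]} {d : ℕ} {N : ℤ} (hfd : f.natDegree ≤ d)
    (hN : IsCoprime N d.factorial) (h : C N ∣ derivative f) (h0 : N ∣ f.coeff 0) : C N ∣ f := by
  rw [C_dvd_iff_dvd_coeff] at h ⊢
  rintro (_ | k)
  · exact h0
  · obtain hk | hk := le_or_gt (k + 1) d
    · have hcoprime : IsCoprime N (k + 1 : ℕ) := hN.of_isCoprime_of_dvd_right
        (Int.natCast_dvd_natCast.mpr (Nat.dvd_factorial k.succ_pos hk))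
      have hk := h k
      rw [coeff_derivative, ← Nat.cast_succ] at hk
      exact hcoprime.dvd_of_dvd_mul_right hk
    · rw [coeff_eq_zero_of_natDegree_lt (hfd.trans_lt hk)]
      exact dvd_zero _

variable {ι : Type*} [Fintype ι] {d : ℕ}

theorem HasCriticalPoints.of_derivative_eq {f : ℤ[X]} {b : ι → ℤ} (hd : 1 < d)
    (hι : Fintype.card ι = d - 1) (h : f.derivative = C (d : ℤ) * ∏ i, (X - C (b i))) :
    HasCriticalPoints f d b := by
  have hd0 : (d : ℤ) ≠ 0 := by exact_mod_cast (by omega : d ≠ 0)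
  have hdeg : f.natDegree = d := by
    have hder := congrArg natDegree h
    rw [natDegree_derivative, natDegree_C_mul hd0, natDegree_finsetProd_X_sub_C_eq_card,
      Finset.card_univ, hι] at hder
    omega
  refine ⟨hd, ?_, hdeg, h⟩
  have hlead := congrArg leadingCoeff h
  rw [leadingCoeff_derivative, leadingCoeff_mul, leadingCoeff_C, hdeg, mul_comm,
    (monic_prod_X_sub_C b Finset.univ).leadingCoeff] at hlead
  exact mul_left_cancel₀ hd0 (by exact_mod_cast hlead)

theorem exists_hasCriticalPoints {b : ι → ℤ} (hd : 1 < d) (hι : Fintype.card ι = d - 1)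
    (hb : ∀ i, (d.factorial : ℤ) ∣ b i) (c : ℤ) :
    ∃ f, HasCriticalPoints f d b ∧ f.coeff 0 = c := by
  have hsub : C (d.factorial : ℤ) ∣ ∏ i, (X - C (b i)) - X ^ (d - 1) := by
    rw [← hι, ← Finset.card_univ, ← Finset.prod_const]
    refine dvd_prod_sub_prod fun i _ => ?_
    rw [sub_sub_cancel_left, dvd_neg]
    exact map_dvd C (hb i)
  have hcoeff (k : ℕ) : (k + 1 : ℤ) ∣ (C (d : ℤ) * ∏ i, (X - C (b i))).coeff k := by
    have hdvd := C_dvd_iff_dvd_coeff _ _ |>.mp hsub k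
    rw [coeff_sub, coeff_X_pow] at hdvd
    rw [coeff_C_mul, ← Nat.cast_succ]
    rcases lt_trichotomy k (d - 1) with hk | rfl | hk
    · rw [if_neg hk.ne, sub_zero] at hdvd
      refine Dvd.dvd.mul_left (dvd_trans ?_ hdvd) _
      exact Int.natCast_dvd_natCast.mpr (Nat.dvd_factorial k.succ_pos (by omega))
    · rw [Nat.succ_eq_add_one, Nat.sub_add_cancel hd.le]
      exact dvd_mul_right _ _
    · rw [coeff_eq_zero_of_natDegree_lt, mul_zero]
      · exact dvd_zero _
      · rwa [natDegree_finsetProd_X_sub_C_eq_card, Finset.card_univ, hι]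
  obtain ⟨f, hf, hc⟩ := exists_derivative_eq hcoeff c
  exact ⟨f, .of_derivative_eq hd hι hf, hc⟩

theorem HasCriticalPoints.C_dvd_sub {f g : ℤ[X]} {b b' : ι → ℤ} (hf : HasCriticalPoints f d b)
    (hg : HasCriticalPoints g d b') {N : ℤ} (hN : IsCoprime N d.factorial)
    (hb : ∀ i, N ∣ b i - b' i) (hc : N ∣ f.coeff 0 - g.coeff 0) : C N ∣ f - g := by
  refine C_dvd_of_C_dvd_derivative (d := d) ?_ hN ?_ (by rwa [coeff_sub])
  · exact (natDegree_sub_le _ _).trans (max_le hf.natDegree_eq.le hg.natDegree_eq.le)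
  · rw [derivative_sub, hf.derivative_eq, hg.derivative_eq, ← mul_sub]
    refine (dvd_prod_sub_prod fun i _ => ?_).mul_left _
    rw [sub_sub_sub_cancel_left, ← C_sub, ← neg_sub, C_neg, dvd_neg]
    exact map_dvd C (hb i)

end Antiderivative

section Congruence

open Polynomial

variable {f g : ℤ[X]} {p : ℕ}

theorem dvd_eval_iterate_sub {N : ℤ} (hfg : C N ∣ f - g) {x y : ℤ} (hxy : N ∣ x - y) (k : ℕ) :
    N ∣ (f.eval ·)^[k] x - (g.eval ·)^[k] y := by
  induction k with
  | zero => exact hxy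
  | succ k ih =>
    rw [Function.iterate_succ_apply', Function.iterate_succ_apply']
    set y' := (g.eval ·)^[k] y
    have heval : N ∣ f.eval y' - g.eval y' := by simpa using eval_dvd (x := y') hfg
    have h := dvd_add (ih.trans (sub_dvd_eval_sub _ y' f)) heval
    rwa [sub_add_sub_cancel] at h

theorem EisensteinPrime.congr {q : ℤ[X]} {D : ℕ} {b b' : ℤ} (h : EisensteinPrime g q D b' p)
    (hfg : C ((p : ℤ) ^ 2) ∣ f - g) (hb : (p : ℤ) ^ 2 ∣ b - b') : EisensteinPrime f q D b p where
  prime := h.prime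
  two_le := h.two_le
  dvd_sub := by
    have hp : C (p : ℤ) ∣ f - g := (_root_.map_dvd C (dvd_pow_self _ two_ne_zero)).trans hfg
    simpa using dvd_add hp h.dvd_sub
  not_dvd := h.not_dvd
  sq_not_dvd := by
    have hcoeff := (C_dvd_iff_dvd_coeff _ _).mp hfg 0
    rw [coeff_sub] at hcoeff
    exact (Int.dvd_iff_dvd_of_dvd_sub hcoeff).not.mpr h.sq_not_dvd
  sq_dvd := (Int.dvd_iff_dvd_of_dvd_sub hb).mpr h.sq_dvd

theorem TranspositionPrime.congr {ι : Type*} {b b' : ι → ℤ} {d m : ℕ} {j : ι}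
    (h : TranspositionPrime g b' d m j p) (hfg : C ((p : ℤ) ^ 2) ∣ f - g)
    (hb : ∀ i, (p : ℤ) ^ 2 ∣ b i - b' i) : TranspositionPrime f b d m j p := by
  have hsq : (p : ℤ) ∣ (p : ℤ) ^ 2 := dvd_pow_self _ two_ne_zero
  have hiter (k : ℕ) (i j : ι) :
      (p : ℤ) ^ 2 ∣ ((f.eval ·)^[k] (b i) - b j) - ((g.eval ·)^[k] (b' i) - b' j) := by
    rw [sub_sub_sub_comm]
    exact dvd_sub (dvd_eval_iterate_sub hfg (hb i) k) (hb j)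
  refine ⟨h.prime, h.not_dvd, ?_, fun i hi => ?_, fun i j' k hk hkm hdvd => ?_⟩
  · obtain ⟨u, hu, hval⟩ := h.exists_val
    obtain ⟨w, hw⟩ := hiter (m + 1) j j
    exact ⟨u + p * w, by rwa [Int.dvd_add_left (dvd_mul_right _ _)],
      by linear_combination hw + hval⟩
  · have hsub : (p : ℤ) ^ 2 ∣ (b i - b j) - (b' i - b' j) := hiter 0 i j
    exact (Int.dvd_iff_dvd_of_dvd_sub (hsq.trans hsub)).not.mpr (h.simple i hi)
  · exact h.orbit i j' k hk hkm
      ((Int.dvd_iff_dvd_of_dvd_sub (hsq.trans (hiter k i j'))).mp hdvd)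

end Congruence

section Models

open Polynomial

variable {ι : Type*} [Fintype ι] {d : ℕ}

theorem hasCriticalPoints_bicritical [DecidableEq ι] (hd : 2 ≤ d) (hι : Fintype.card ι = d - 1)
    (i₀ : ι) (B : ℕ) (c : ℤ) :
    HasCriticalPoints (bicritical d B (C c) X) d (Pi.single i₀ ((d - 1) * B) : ι → ℤ) := by
  refine .of_derivative_eq hd hι ?_
  rw [← Finset.mul_prod_erase _ _ (Finset.mem_univ i₀), Pi.single_eq_same,
    Finset.prod_congr rfl (g := fun _ => X) (fun i hi => by
      rw [Pi.single_eq_of_ne (Finset.ne_of_mem_erase hi), C_0, sub_zero]),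
    Finset.prod_const, Finset.card_erase_of_mem (Finset.mem_univ _), Finset.card_univ, hι]
  obtain ⟨e, rfl⟩ := Nat.exists_eq_add_of_le' hd
  simp only [bicritical, derivative_add, derivative_sub, derivative_C, derivative_X_pow,
    derivative_mul, derivative_natCast, map_natCast, Nat.add_sub_cancel, C_mul, C_sub, C_1,
    show e + 2 - 1 = e + 1 from rfl]
  push_cast
  ring

theorem not_sq_dvd_self {p : ℕ} (hp : p.Prime) : ¬ (p : ℤ) ^ 2 ∣ p := by
  have hp' := Nat.prime_iff_prime_int.mp hp
  simpa using (pow_dvd_pow_iff (n := 2) (m := 1) hp'.ne_zero hp'.not_isUnit).not.mpr (by decide)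

theorem eisensteinPrime_bicritical_zero (hd : 2 ≤ d) {p : ℕ} (hp : p.Prime) :
    EisensteinPrime (bicritical d 0 (C (p : ℤ)) X) 1 d 0 p where
  prime := hp
  two_le := hd
  dvd_sub := by simp [bicritical]
  not_dvd := by simpa using (Nat.prime_iff_prime_int.mp hp).not_dvd_one
  sq_not_dvd := by
    rw [coeff_zero_eq_eval_zero, eval_bicritical, bicritical_zero hd]
    exact not_sq_dvd_self hp
  sq_dvd := dvd_zero _

theorem eisensteinPrime_bicritical_one (hd : 3 ≤ d) {p : ℕ} (hp : p.Prime) (hpd : d < p) :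
    EisensteinPrime (bicritical d 1 (C (p : ℤ)) X) (X - C (d : ℤ)) (d - 1) 0 p where
  prime := hp
  two_le := by omega
  dvd_sub := by simp [bicritical_eq_mul_add (show d ≠ 0 by omega)]
  not_dvd := by
    simpa [Int.natCast_dvd_natCast] using Nat.not_dvd_of_pos_of_lt (by omega) hpd
  sq_not_dvd := by
    rw [coeff_zero_eq_eval_zero, eval_bicritical, bicritical_zero (by omega)]
    exact not_sq_dvd_self hp
  sq_dvd := dvd_zero _

end Models

section LocalCondition

open Polynomial

variable {ι : Type*}

/-- The local conditions of `HasCriticalPoints.nonempty_gal_mulEquiv` at the prime `p`, one for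
each index of the disjoint union. -/
def LocalCondition (d n : ℕ) : ι ⊕ ι ⊕ ι × Fin n → ℕ → ℤ[X] → (ι → ℤ) → Prop
  | .inl j, p, f, b => EisensteinPrime f 1 d (b j) p
  | .inr (.inl j), p, f, b => 3 ≤ d → ∃ c, EisensteinPrime f (X - C c) (d - 1) (b j) p
  | .inr (.inr (j, k)), p, f, b => TranspositionPrime f b d k j p

theorem LocalCondition.congr {n p : ℕ} {ρ : ι ⊕ ι ⊕ ι × Fin n} {f g : ℤ[X]} {b b' : ι → ℤ}
    (h : LocalCondition d n ρ p g b') (hfg : C ((p : ℤ) ^ 2) ∣ f - g)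
    (hb : ∀ i, (p : ℤ) ^ 2 ∣ b i - b' i) : LocalCondition d n ρ p f b := by
  rcases ρ with j | j | ⟨j, k⟩
  · exact EisensteinPrime.congr h hfg (hb j)
  · exact fun hd => (h hd).imp fun _ hc => hc.congr hfg (hb j)
  · exact TranspositionPrime.congr h hfg hb

end LocalCondition

section ChineseRemainder

theorem exists_injective_forall_mem_of_infinite {J α : Type*} [Finite J] {S : J → Set α}
    (hS : ∀ j, (S j).Infinite) : ∃ φ : J → α, Function.Injective φ ∧ ∀ j, φ j ∈ S j := by
  classical
  have := Fintype.ofFinite J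
  choose t ht hcard using fun j => (hS j).exists_subset_card_eq (Fintype.card J)
  have hall (s : Finset J) : s.card ≤ (s.biUnion t).card := by
    rcases s.eq_empty_or_nonempty with rfl | ⟨j, hj⟩
    · simp
    · exact s.card_le_univ.trans
        ((hcard j).ge.trans (Finset.card_le_card (Finset.subset_biUnion_of_mem t hj)))
  obtain ⟨φ, hφ, hmem⟩ := (Finset.all_card_le_biUnion_card_iff_exists_injective t).mp hall
  exact ⟨φ, hφ, fun j => ht j (hmem j)⟩

theorem exists_dvd_and_forall_dvd_sub {J : Type*} [Finite J] {a : ℤ} {μ : J → ℤ}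
    (hμ : Pairwise (Function.onFun IsCoprime μ)) (ha : ∀ j, IsCoprime (μ j) a) (x : J → ℤ) :
    ∃ y, a ∣ y ∧ ∀ j, μ j ∣ y - x j := by
  choose u v huv using ha
  obtain ⟨t, ht⟩ := Ideal.exists_forall_sub_mem_ideal (I := fun j => Ideal.span {μ j})
    (fun i j hij => (Ideal.isCoprime_span_singleton_iff _ _).mpr (hμ hij)) (fun j => v j * x j)
  refine ⟨a * t, dvd_mul_right _ _, fun j => ?_⟩
  obtain ⟨w, hw⟩ := Ideal.mem_span_singleton.mp (ht j)
  exact ⟨a * w - u j * x j, by linear_combination a * hw + x j * huv j⟩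

open Polynomial

variable {ι J : Type*} [Fintype ι] [Finite J] {d : ℕ}

theorem exists_class_forall_dvd_sub (hd : 1 < d) (hι : Fintype.card ι = d - 1) {p : J → ℕ}
    (hinj : Function.Injective p) (hp : ∀ ρ, (p ρ).Prime) (hpd : ∀ ρ, d < p ρ) {g : J → ℤ[X]}
    {b' : J → ι → ℤ} (hg : ∀ ρ, HasCriticalPoints (g ρ) d (b' ρ)) :
    ∃ (M : ℤ) (b₀ : ι → ℤ) (c₀ : ℤ), M ≠ 0 ∧ ∀ (b : ι → ℤ) (c : ℤ), (∀ i, M ∣ b i - b₀ i) →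
      M ∣ c - c₀ → ∃ f, HasCriticalPoints f d b ∧ f.coeff 0 = c ∧
        ∀ ρ, C ((p ρ : ℤ) ^ 2) ∣ f - g ρ ∧ ∀ i, (p ρ : ℤ) ^ 2 ∣ b i - b' ρ i := by
  classical
  have := Fintype.ofFinite J
  have hpair : Pairwise (Function.onFun IsCoprime fun ρ => (p ρ : ℤ) ^ 2) := fun ρ ρ' hne =>
    (Nat.isCoprime_iff_coprime.mpr
      ((Nat.coprime_primes (hp ρ) (hp ρ')).mpr (hinj.ne hne))).pow
  have hfac (ρ) : IsCoprime ((p ρ : ℤ) ^ 2) d.factorial :=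
    (Nat.isCoprime_iff_coprime.mpr ((hp ρ).coprime_factorial_of_lt (hpd ρ))).pow_left
  choose b₀ hb₀fac hb₀ using fun i => exists_dvd_and_forall_dvd_sub hpair hfac fun ρ => b' ρ i
  obtain ⟨c₀, -, hc₀⟩ := exists_dvd_and_forall_dvd_sub hpair hfac fun ρ => (g ρ).coeff 0
  refine ⟨d.factorial * ∏ ρ, (p ρ : ℤ) ^ 2, b₀, c₀, mul_ne_zero ?_ ?_, fun b c hb hc => ?_⟩
  · exact_mod_cast d.factorial_ne_zero
  · exact Finset.prod_ne_zero_iff.mpr fun ρ _ => pow_ne_zero _ (by exact_mod_cast (hp ρ).ne_zero)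
  have hM (ρ) : (p ρ : ℤ) ^ 2 ∣ d.factorial * ∏ ρ, (p ρ : ℤ) ^ 2 :=
    (Finset.dvd_prod_of_mem _ (Finset.mem_univ ρ)).mul_left _
  have hbρ (ρ i) : (p ρ : ℤ) ^ 2 ∣ b i - b' ρ i := by
    simpa using dvd_add ((hM ρ).trans (hb i)) (hb₀ i ρ)
  obtain ⟨f, hf, rfl⟩ := exists_hasCriticalPoints hd hι (fun i =>
    (Int.dvd_iff_dvd_of_dvd_sub ((dvd_mul_right _ _).trans (hb i))).mpr (hb₀fac i)) c
  refine ⟨f, hf, rfl, fun ρ => ⟨hf.C_dvd_sub (hg ρ) (hfac ρ) (hbρ ρ) ?_, hbρ ρ⟩⟩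
  simpa using dvd_add ((hM ρ).trans hc) (hc₀ ρ)

theorem exists_localCondition (hd : 2 ≤ d) (hι : Fintype.card ι = d - 1) {n : ℕ}
    (ρ : ι ⊕ ι ⊕ ι × Fin n) (N : ℕ) :
    ∃ p : ℕ, N < p ∧ p.Prime ∧ ∃ f b, HasCriticalPoints f d b ∧ LocalCondition d n ρ p f b := by
  classical
  obtain ⟨p, hNp, hp⟩ := Nat.exists_infinite_primes (max N d + 1)
  obtain ⟨hN, hpd⟩ := max_lt_iff.mp (Nat.lt_of_succ_le hNp)
  rcases ρ with j | j | ⟨j, k⟩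
  · refine ⟨p, hN, hp, _, _, hasCriticalPoints_bicritical hd hι j 0 p, ?_⟩
    have h := eisensteinPrime_bicritical_zero hd hp
    simpa [LocalCondition] using h
  · obtain hd3 | hd3 := lt_or_ge d 3
    · exact ⟨p, hN, hp, _, _, hasCriticalPoints_bicritical hd hι j 0 p,
        fun h => absurd h hd3.not_ge⟩
    · have : Nontrivial ι := Fintype.one_lt_card_iff_nontrivial.mp (by omega)
      obtain ⟨i₀, hi₀⟩ := exists_ne j
      refine ⟨p, hN, hp, _, _, hasCriticalPoints_bicritical hd hι i₀ 1 p, fun _ => ⟨d, ?_⟩⟩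
      rw [Pi.single_eq_of_ne hi₀.symm]
      exact eisensteinPrime_bicritical_one hd3 hp hpd
  · obtain ⟨p, c, hN, h⟩ := exists_transpositionPrime_bicritical hd le_rfl j k N
    exact ⟨p, hN, h.prime, _, _, hasCriticalPoints_bicritical hd hι j _ c, h⟩

theorem exists_class_localCondition (hd : 1 < d) (hι : Fintype.card ι = d - 1) (n N : ℕ) :
    ∃ (M : ℤ) (b₀ : ι → ℤ) (c₀ : ℤ), M ≠ 0 ∧ ∀ (b : ι → ℤ) (c : ℤ), (∀ i, M ∣ b i - b₀ i) →
      M ∣ c - c₀ → ∃ f, HasCriticalPoints f d b ∧ f.coeff 0 = c ∧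
        ∀ ρ, ∃ p, N < p ∧ LocalCondition d n ρ p f b := by
  obtain ⟨p, hinj, hp⟩ := exists_injective_forall_mem_of_infinite
    (S := fun ρ : ι ⊕ ι ⊕ ι × Fin n => {p : ℕ | max N d < p ∧ p.Prime ∧
      ∃ f b, HasCriticalPoints f d b ∧ LocalCondition d n ρ p f b}) fun ρ =>
    Set.infinite_of_forall_exists_gt fun N' => by
      obtain ⟨p, hlt, h⟩ := exists_localCondition hd hι ρ (max N' (max N d))
      rw [max_lt_iff] at hlt
      exact ⟨p, ⟨hlt.2, h⟩, hlt.1⟩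
  choose hlt hprime g b' hg hloc using hp
  obtain ⟨M, b₀, c₀, hM, h⟩ := exists_class_forall_dvd_sub hd hι hinj hprime
    (fun ρ => (le_max_right _ _).trans_lt (hlt ρ)) hg
  refine ⟨M, b₀, c₀, hM, fun b c hb hc => ?_⟩
  obtain ⟨f, hf, hfc, hfg⟩ := h b c hb hc
  exact ⟨f, hf, hfc, fun ρ => ⟨p ρ, (le_max_left _ _).trans_lt (hlt ρ),
    (hloc ρ).congr (hfg ρ).1 (hfg ρ).2⟩⟩

theorem exists_class_nonempty_gal_mulEquiv (K : Type*) [Field K] [NumberField K] (hd : 1 < d)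
    (hι : Fintype.card ι = d - 1) (n : ℕ) :
    ∃ (M : ℤ) (b₀ : ι → ℤ) (c₀ : ℤ), M ≠ 0 ∧ ∀ (b : ι → ℤ) (c : ℤ), Function.Injective b →
      (∀ i, M ∣ b i - b₀ i) → M ∣ c - c₀ → ∃ f, HasCriticalPoints f d b ∧ f.coeff 0 = c ∧
        Nonempty (((derivative (f.map (algebraMap ℤ K))).comp
          (polyIterate (f.map (algebraMap ℤ K)) n)).Gal ≃* (ι → iteratedSymWreath d n)) := by
  obtain ⟨M, b₀, c₀, hM, h⟩ :=
    exists_class_localCondition hd hι n (NumberField.discr K).natAbs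
  have hdiscr {p : ℕ} (hp : (NumberField.discr K).natAbs < p) : ¬ (p : ℤ) ∣ NumberField.discr K :=
    fun hdvd => Nat.not_dvd_of_pos_of_lt (Int.natAbs_pos.mpr (NumberField.discr_ne_zero K)) hp
      (Int.natCast_dvd.mp hdvd)
  refine ⟨M, b₀, c₀, hM, fun b c hinj hb hc => ?_⟩
  obtain ⟨f, hf, hfc, hloc⟩ := h b c hb hc
  refine ⟨f, hf, hfc, hf.nonempty_gal_mulEquiv K hinj (fun j => ?_) (fun hd3 j => ?_)
    fun k hk j => ?_⟩
  · obtain ⟨p, hp, hE⟩ := hloc (.inl j)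
    exact ⟨p, hdiscr hp, hE⟩
  · obtain ⟨p, hp, hC⟩ := hloc (.inr (.inl j))
    obtain ⟨c, hc⟩ := hC hd3
    exact ⟨p, c, hdiscr hp, hc⟩
  · obtain ⟨p, hp, hT⟩ := hloc (.inr (.inr (j, ⟨k, hk⟩)))
    exact ⟨p, hdiscr hp, hT⟩

end ChineseRemainder

section ZariskiDensity

open MvPolynomial

theorem isZariskiDense_of_forall {K σ : Type*} [Field K] {S : Set (σ → K)}
    (h : ∀ P : MvPolynomial σ K, (∀ v ∈ S, aeval v P = 0) → P = 0) : IsZariskiDense S := by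
  rw [IsZariskiDense, Set.eq_univ_iff_forall]
  intro x P hP
  rw [h P hP, map_zero]

theorem exists_ne_zero_forall_eval_eq_zero_of_not_injective (R σ : Type*) [CommRing R] [IsDomain R]
    [Finite σ] :
    ∃ D : MvPolynomial σ R, D ≠ 0 ∧ ∀ v, ¬ Function.Injective v → eval v D = 0 := by
  classical
  have := Fintype.ofFinite σ
  refine ⟨∏ x ∈ (Finset.univ : Finset σ).offDiag, (X x.1 - X x.2),
    Finset.prod_ne_zero_iff.mpr fun x hx =>
      sub_ne_zero.mpr fun h => (Finset.mem_offDiag.mp hx).2.2 (X_injective h), fun v hv => ?_⟩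
  obtain ⟨i, j, hij, hne⟩ := Function.not_injective_iff.mp hv
  rw [map_prod]
  refine Finset.prod_eq_zero (i := (i, j)) (by simpa using hne) ?_
  rw [map_sub, eval_X, eval_X, hij, sub_self]

theorem isZariskiDense_pi_inter_injective {K σ : Type*} [Field K] [Finite σ] {S : σ → Set K}
    (hS : ∀ i, (S i).Infinite) : IsZariskiDense {v | Function.Injective v ∧ ∀ i, v i ∈ S i} := by
  refine isZariskiDense_of_forall fun P hP => ?_
  obtain ⟨D, hD0, hD⟩ := exists_ne_zero_forall_eval_eq_zero_of_not_injective K σ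
  refine (mul_eq_zero.mp (funext_set S hS fun v hv => ?_)).resolve_right hD0
  rw [map_mul, map_zero, mul_eq_zero, or_iff_not_imp_right]
  intro hv0
  rw [← aeval_eq_eval]
  exact hP v ⟨not_imp_comm.mp (hD v) hv0, fun i => hv i (Set.mem_univ i)⟩

theorem infinite_image_intCast_dvd_sub (R : Type*) [AddGroupWithOne R] [CharZero R] {M : ℤ}
    (hM : M ≠ 0) (a : ℤ) : (Int.cast '' {z : ℤ | M ∣ z - a} : Set R).Infinite := by
  refine Set.Infinite.image Int.cast_injective.injOn ?_
  refine (Set.infinite_range_of_injective (f := fun t => a + M * t) fun t t' h =>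
    mul_left_cancel₀ hM (add_left_cancel h)).mono ?_
  rintro _ ⟨t, rfl⟩
  exact ⟨t, add_sub_cancel_left _ _⟩

end ZariskiDensity

section Parameters

variable {K : Type*} {d : ℕ}

theorem paramPoint_castLE (b : Fin (d - 1) → K) (c : K) (i : Fin (d - 1)) :
    paramPoint b c (i.castLE (Nat.sub_le d 1)) = b i := by
  simp [paramPoint]

theorem paramPoint_mk_sub_one (b : Fin (d - 1) → K) (c : K) (hd : d - 1 < d) :
    paramPoint b c ⟨d - 1, hd⟩ = c := by
  simp [paramPoint]

theorem injective_of_injective_paramPoint {b : Fin (d - 1) → K} {c : K}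
    (h : Function.Injective (paramPoint b c)) : Function.Injective b := by
  simpa only [Function.comp_def, paramPoint_castLE] using
    h.comp (Fin.castLE_injective (Nat.sub_le d 1))

open Polynomial

theorem eq_of_derivative_eq {R : Type*} [Ring R] [IsAddTorsionFree R] {f g : R[X]}
    (h : derivative f = derivative g) (h0 : f.coeff 0 = g.coeff 0) : f = g := by
  rw [← sub_eq_zero, ← derivative_sub] at h
  have hC := eq_C_of_natDegree_eq_zero (derivative_eq_zero.mp h)
  rwa [coeff_sub, h0, sub_self, C_0, sub_eq_zero] at hC

theorem derivative_eq_C_mul_prod {ι : Type*} [Field K] [CharZero K] [Fintype ι] {f : K[X]}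
    {b : ι → K} (hf : f.Monic) (hι : Fintype.card ι = f.natDegree - 1)
    (hroots : f.derivative.roots = Finset.univ.val.map b) :
    derivative f = C (f.natDegree : K) * ∏ i, (X - C (b i)) := by
  have hcard : f.derivative.roots.card = f.derivative.natDegree := by
    rw [hroots, natDegree_derivative, Multiset.card_map, Finset.card_val, Finset.card_univ, hι]
  rw [← C_leadingCoeff_mul_prod_multiset_X_sub_C hcard, leadingCoeff_derivative, hf.leadingCoeff,
    one_mul, hroots, Multiset.map_map, Finset.prod_eq_multiset_prod, Function.comp_def]

theorem HasCriticalPoints.eq_map [Field K] [CharZero K] {f : K[X]} {g : ℤ[X]}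
    {b : Fin (d - 1) → ℤ} (hg : HasCriticalPoints g d b) (hf : f.Monic) (hfd : f.natDegree = d)
    (hroots : f.derivative.roots = Finset.univ.val.map fun i => (b i : K))
    (h0 : f.coeff 0 = g.coeff 0) : f = g.map (algebraMap ℤ K) := by
  refine eq_of_derivative_eq ?_ (by rw [h0, coeff_map, eq_intCast])
  rw [derivative_eq_C_mul_prod hf (by rw [hfd, Fintype.card_fin]) hroots, hfd, derivative_map,
    hg.derivative_eq]
  simp [Polynomial.map_prod]

end Parameters

theorem corollary3p7 (K : Type*) [Field K] [NumberField K] (d n : ℕ) (hd : 1 < d) :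
    ∃ H : Set (Fin d → K), IsZariskiDense H ∧
      ∀ (f : Polynomial K) (b : Fin (d - 1) → K),
        f.Monic → f.natDegree = d →
        f.derivative.roots = Finset.univ.val.map b →
        paramPoint b (f.coeff 0) ∈ H →
        Nonempty ((f.derivative.comp (polyIterate f n)).Gal ≃*
          (Fin (d - 1) → iteratedSymWreath d n)) := by
  obtain ⟨M, b₀, c₀, hM, h⟩ := exists_class_nonempty_gal_mulEquiv K hd (Fintype.card_fin _) n
  refine ⟨_, isZariskiDense_pi_inter_injective fun i =>
    infinite_image_intCast_dvd_sub K hM (paramPoint b₀ c₀ i), ?_⟩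
  rintro f b hf hfd hroots ⟨hinj, hmem⟩
  have hb (i : Fin (d - 1)) : b i ∈ (Int.cast '' {z : ℤ | M ∣ z - b₀ i} : Set K) := by
    simpa only [paramPoint_castLE] using hmem (i.castLE (Nat.sub_le d 1))
  obtain ⟨c, hcM, hc⟩ : f.coeff 0 ∈ (Int.cast '' {z : ℤ | M ∣ z - c₀} : Set K) := by
    simpa only [paramPoint_mk_sub_one] using hmem ⟨d - 1, Nat.sub_one_lt_of_lt hd⟩
  choose z hzM hz using hb
  obtain rfl : (fun i => (z i : K)) = b := funext hz
  obtain ⟨g, hg, hgc, hG⟩ :=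
    h z c (injective_of_injective_paramPoint hinj).of_comp hzM hcM
  rwa [hg.eq_map hf hfd hroots (by rw [hgc, hc])]
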